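/- A multiplicity sequence $\Lambda=\{\lambda_n,\mu_n\}_{n=1}^{\infty}$ consists of distinct complex numbers $\lambda_n$ with $0<|\lambda_n|\le|\lambda_{n+1}|$, $|\lambda_n|\to\infty$, and $-\pi<\arg\lambda_n<\arg\lambda_{n+1}\le\pi$ whenever $|\lambda_n|=|\lambda_{n+1}|$, together with positive integers $\mu_n$. Let $A^0_{|z|}$ be the space of entire functions $f$ such that for every $\epsilon>0$ there is $M_\epsilon>0$ with $|f(z)|\le M_\epsilon e^{\epsilon|z|}$ for all $z\in\mathbb C$. The sequence $\Lambda$ is called an interpolating variety for $A^0_{|z|}$ if for every doubly-indexed family of complex numbers $\{a_{n,k}: n\in\mathbb N,\ 0\le k<\mu_n\}$ with $\sup_{n}\sum_{k=0}^{\mu_n-1}|a_{n,k}|e^{-\epsilon|\lambda_n|}<\infty$ for all $\epsilon>0$ there is $f\in A^0_{|z|}$ with $f^{(k)}(\lambda_n)/k!=a_{n,k}$ for all $n\in\mathbb N$ and $0\le k<\mu_n$. Let $\Lambda$ be a multiplicity sequence that is an interpolating variety for $A^0_{|z|}$ and suppose that $\sup_n|\arg\lambda_n|\le\eta$ for some $\eta\in[0,\pi/2)$.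 For $\beta\in\mathbb R$ let $$\Theta_{\eta,\beta}=\Big\{z\in\mathbb C:\ \Re z<\beta,\ \Big|\frac{\Im z}{\Re(z-\beta)}\Big|<\frac1{\tan\eta}\Big\}\quad(\eta>0),\qquad \Theta_{0,\beta}=\{z\in\mathbb C:\Re z<\beta\}.$$ Consider a Taylor–Dirichlet series $$g(z)=\sum_{n=1}^{\infty}\Big(\sum_{k=0}^{\mu_n-1}c_{n,k}z^k\Big)e^{\lambda_nz},\qquad c_{n,k}\in\mathbb C .$$ (1) The series converges uniformly on the compact subsets of $\Theta_{\eta,\beta}$, defining an analytic function there, if and only if for every $\epsilon>0$ there is $m_\epsilon>0$ such that $|c_{n,k}|\le m_\epsilon e^{(-\beta+\epsilon)\Re\lambda_n}$ for all $n\in\mathbb N$ and $k=0,1,\dots,\mu_n-1$. (2) In this case there is an open convex set $D\supseteq\Theta_{\eta,\beta}$ such that the series converges uniformly on the compact subsets of $D$ to an analytic function $g$, and either $D=\mathbb C$ (so $g$ is entire), or $D\ne\mathbb C$ and the boundary of $D$ is a natural boundary for $g$: for no $z_0\in\partial D$ is there a function analytic in a neighbourhood of $z_0$ that agrees with $g$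 at all points of $D$ sufficiently near $z_0$. -/

import Mathlib

/-- A multiplicity sequence `Λ = {λₙ, μₙ}`: distinct nonzero complex numbers `λₙ` diverging to
infinity, ordered by modulus and, for equal moduli, by argument in `(-π, π]`, together with
positive integers `μₙ`. The index set is `ℕ = {0, 1, 2, …}`. -/
structure IsMultiplicitySequence (lam : ℕ → ℂ) (mu : ℕ → ℕ) : Prop where
  ne_zero : ∀ n, lam n ≠ 0
  injective : Function.Injective lam
  tendsto_norm : Filter.Tendsto (fun n => ‖lam n‖) Filter.atTop Filter.atTop
  norm_le : ∀ n, ‖lam n‖ ≤ ‖lam (n + 1)‖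
  arg_lt : ∀ n, ‖lam n‖ = ‖lam (n + 1)‖ → (lam n).arg < (lam (n + 1)).arg
  mult_pos : ∀ n, 0 < mu n

/-- The space of entire functions of exponential type zero. -/
def IsEntireOfTypeZero (f : ℂ → ℂ) : Prop :=
  Differentiable ℂ f ∧
    ∀ ε : ℝ, 0 < ε → ∃ M : ℝ, 0 < M ∧ ∀ z : ℂ, ‖f z‖ ≤ M * Real.exp (ε * ‖z‖)

/-- `Λ` is an interpolating variety for the space of entire functions of exponential type zero.
Only the values `a n k` with `k < mu n` matter. -/
def IsInterpolatingVariety (lam : ℕ → ℂ) (mu : ℕ → ℕ) : Prop :=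
  ∀ a : ℕ → ℕ → ℂ,
    (∀ ε : ℝ, 0 < ε → BddAbove (Set.range fun n : ℕ =>
      ∑ k ∈ Finset.range (mu n), ‖a n k‖ * Real.exp (-ε * ‖lam n‖))) →
    ∃ f : ℂ → ℂ, IsEntireOfTypeZero f ∧
      ∀ n : ℕ, ∀ k < mu n, iteratedDeriv k f (lam n) / (k.factorial : ℂ) = a n k

/-- The open sector `Θ_{η,β} = {z : Re z < β, |Im z / Re (z - β)| < 1 / tan η}` with vertex `β`,
for `0 ≤ η < π / 2`, written without division; for `η = 0` it is the half-plane `Re z < β`. -/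
def openSector (η β : ℝ) : Set ℂ :=
  {z : ℂ | z.re < β ∧ |z.im| * Real.tan η < β - z.re}

/-- The partial sums of the Taylor–Dirichlet series
`∑ₙ (∑_{k < μₙ} c_{n,k} z ^ k) e ^ (λₙ z)`: the sum of its first `N` groups of terms. -/
noncomputable def taylorDirichletPartialSum (lam : ℕ → ℂ) (mu : ℕ → ℕ) (c : ℕ → ℕ → ℂ)
    (N : ℕ) (z : ℂ) : ℂ :=
  ∑ n ∈ Finset.range N, (∑ k ∈ Finset.range (mu n), c n k * z ^ k) * Complex.exp (lam n * z)

/-- The Taylor–Dirichlet series converges uniformly on the compact subsets of the (open) set `U`,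
and its sum there is the analytic function `g`. -/
def TaylorDirichletDefines (lam : ℕ → ℂ) (mu : ℕ → ℕ) (c : ℕ → ℕ → ℂ)
    (g : ℂ → ℂ) (U : Set ℂ) : Prop :=
  AnalyticOnNhd ℂ g U ∧
    ∀ K : Set ℂ, K ⊆ U → IsCompact K →
      TendstoUniformlyOn (taylorDirichletPartialSum lam mu c) g Filter.atTop K

/-- The boundary of the convex region `D` is a natural boundary of `g`, a function on `D`: at no
boundary point `z₀` is there an analytic germ that agrees with `g` on `D` near `z₀`. (For convex `D`
the intersection of `D` with a small disk about `z₀` is connected, so agreement on a nonempty open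
part of it is the same.) -/
def IsNaturalBoundary (g : ℂ → ℂ) (D : Set ℂ) : Prop :=
  ∀ z₀ ∈ frontier D, ¬ ∃ G : ℂ → ℂ, AnalyticAt ℂ G z₀ ∧ ∀ᶠ z in nhdsWithin z₀ D, G z = g z

open Filter Topology Polynomial

/-! Interpolating `1` at one node and `0` at all others, with multiplicity, gives a type-zero
function with zeros at those nodes. Jensen's inequality then forces density zero, so multiplicities
cost only factors `e^(ε|λₙ|)` and `∑ e^(-ε|λₙ|)` converges.

Take `D` to be `decayRegion`. Since `Re (λₙ z)` is real-linear in `z`, `D` is convex, and the series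
converges on it. The coefficient bounds put the sector inside `D`. Conversely, convergence bounds
the terms on a small disc near `β`, and Cauchy's estimates recover the coefficient bounds
(`TaylorDirichletDefines.coeff_bound`).

For the natural boundary, suppose `g` continues analytically to `z₀ ∈ ∂D`. The terms do not decay
exponentially at `z₀` along a sparse subsequence (`exists_sparse_subsequence`). Interpolation yields
`F` of type zero such that `F(d/dz)` kills every other term and turns each chosen one into a
function equal to `1` at `z₀`. This operator is local and bounded on analytic germs, so `F(d/dz) g`
stays bounded near `z₀`. But at a point of `D` at distance about `1/|λ|` from `z₀`, with `λ` the
`K`-th chosen frequency, the first terms are all near `1` and the rest are negligible, so the sum is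
at least about `2K/3`: a contradiction. -/

/-! ### Zero counting and the density of interpolating varieties -/

theorem Differentiable.exists_eq_sub_pow_mul {f : ℂ → ℂ} (hf : Differentiable ℂ f) (a : ℂ) (m : ℕ)
    (h : (m : ℕ∞) ≤ analyticOrderAt f a) :
    ∃ g : ℂ → ℂ, Differentiable ℂ g ∧ ∀ z, f z = (z - a) ^ m * g z := by
  induction m with
  | zero => exact ⟨f, hf, by simp⟩
  | succ m ih =>
    obtain ⟨g, hg, hfg⟩ := ih (le_trans (by exact_mod_cast m.le_succ) h)
    have hga : g a = 0 := by
      by_contra hne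
      have h1 : analyticOrderAt g a = 0 := (hg.analyticAt a).analyticOrderAt_eq_zero.2 hne
      have h2 : f = (fun z => (z - a) ^ m) * g := funext hfg
      have h3 : analyticOrderAt (fun z : ℂ => (z - a) ^ m) a = m := analyticOrderAt_centeredMonomial
      rw [h2, analyticOrderAt_mul (by fun_prop) (hg.analyticAt a), h1, h3, add_zero] at h
      have : m + 1 ≤ m := by exact_mod_cast h
      omega
    refine ⟨dslope g a, ?_, fun z => ?_⟩
    · rw [← differentiableOn_univ] at hg ⊢
      exact (Complex.differentiableOn_dslope univ_mem).2 hg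
    · have := sub_smul_dslope g a z
      rw [hga, sub_zero, smul_eq_mul] at this
      rw [hfg, ← this]; ring

theorem Differentiable.exists_eq_prod_mul {f : ℂ → ℂ} (hf : Differentiable ℂ f) {ι : Type*}
    [DecidableEq ι] {x : ι → ℂ} (hx : Function.Injective x) (m : ι → ℕ) (s : Finset ι)
    (h : ∀ i ∈ s, (m i : ℕ∞) ≤ analyticOrderAt f (x i)) :
    ∃ g : ℂ → ℂ, Differentiable ℂ g ∧ ∀ z, f z = (∏ i ∈ s, (z - x i) ^ m i) * g z := by
  induction s using Finset.induction_on with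
  | empty => exact ⟨f, hf, by simp⟩
  | insert a s ha ih =>
    obtain ⟨g, hg, hfg⟩ := ih fun i hi => h i (Finset.mem_insert_of_mem hi)
    have hord := h a (Finset.mem_insert_self a s)
    have hd : Differentiable ℂ fun z : ℂ => ∏ i ∈ s, (z - x i) ^ m i := by fun_prop
    have h1 : analyticOrderAt (fun z : ℂ => ∏ i ∈ s, (z - x i) ^ m i) (x a) = 0 := by
      refine (hd.analyticAt _).analyticOrderAt_eq_zero.2 (Finset.prod_ne_zero_iff.2 fun i hi => ?_)
      refine pow_ne_zero _ (sub_ne_zero.2 fun he => ha ?_)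
      rw [hx he]; exact hi
    have h2 : f = (fun z : ℂ => ∏ i ∈ s, (z - x i) ^ m i) * g := funext hfg
    rw [h2, analyticOrderAt_mul (hd.analyticAt _) (hg.analyticAt _), h1, zero_add] at hord
    obtain ⟨g', hg', hgg⟩ := hg.exists_eq_sub_pow_mul (x a) (m a) hord
    refine ⟨g', hg', fun z => ?_⟩
    rw [hfg, hgg, Finset.prod_insert ha]; ring

/-- A form of Jensen's inequality: an entire function with value `1` at `c` and many zeros near `c`
has to be large on a circle about `c`. -/
theorem three_pow_sum_le_of_zeros {f : ℂ → ℂ} (hf : Differentiable ℂ f) {ι : Type*}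
    [DecidableEq ι] {x : ι → ℂ} (hx : Function.Injective x) (m : ι → ℕ) (s : Finset ι)
    (h : ∀ i ∈ s, (m i : ℕ∞) ≤ analyticOrderAt f (x i)) {c : ℂ} (hc : f c = 1) {r B : ℝ}
    (hr : 0 < r) (hxr : ∀ i ∈ s, ‖x i - c‖ ≤ r) (hB : ∀ z, ‖z - c‖ = 4 * r → ‖f z‖ ≤ B) :
    (3 : ℝ) ^ (∑ i ∈ s, m i) ≤ B := by
  obtain ⟨g, hg, hfg⟩ := hf.exists_eq_prod_mul hx m s h
  have hN : 0 < (3 * r) ^ (∑ i ∈ s, m i) := by positivity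
  have hgc : ‖g c‖ ≤ B / (3 * r) ^ (∑ i ∈ s, m i) := by
    -- Maximum principle for the zero-free quotient: on the circle of radius `4r` each factor is at
    -- least `4r - r = 3r`.
    refine Complex.norm_le_of_forall_mem_frontier_norm_le (U := Metric.ball c (4 * r))
      Metric.isBounded_ball hg.diffContOnCl (fun z hz => ?_)
      (subset_closure (Metric.mem_ball_self (by positivity)))
    rw [frontier_ball _ (by positivity), mem_sphere_iff_norm] at hz
    rw [le_div_iff₀ hN]
    refine le_trans ?_ (hB z hz)
    rw [hfg, norm_mul, mul_comm, norm_prod, ← Finset.prod_pow_eq_pow_sum]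
    refine mul_le_mul_of_nonneg_right (Finset.prod_le_prod (fun _ _ => by positivity)
      fun i hi => ?_) (norm_nonneg _)
    rw [norm_pow]
    refine pow_le_pow_left₀ (by positivity) ?_ _
    have h1 : z - c = (z - x i) + (x i - c) := by ring
    have h2 := norm_add_le (z - x i) (x i - c)
    rw [← h1, hz] at h2
    linarith [hxr i hi]
  have hprod : ‖∏ i ∈ s, (c - x i) ^ m i‖ ≤ r ^ (∑ i ∈ s, m i) := by
    rw [norm_prod, ← Finset.prod_pow_eq_pow_sum]
    refine Finset.prod_le_prod (fun _ _ => norm_nonneg _) fun i hi => ?_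
    rw [norm_pow, norm_sub_rev]
    exact pow_le_pow_left₀ (norm_nonneg _) (hxr i hi) _
  have h1 : (1 : ℝ) ≤ r ^ (∑ i ∈ s, m i) * (B / (3 * r) ^ (∑ i ∈ s, m i)) := by
    calc (1 : ℝ) = ‖f c‖ := by simp [hc]
      _ = ‖∏ i ∈ s, (c - x i) ^ m i‖ * ‖g c‖ := by rw [hfg, norm_mul]
      _ ≤ _ := mul_le_mul hprod hgc (norm_nonneg _) (by positivity)
  rw [mul_pow] at h1
  have h2 : (0 : ℝ) < r ^ (∑ i ∈ s, m i) := by positivity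
  have h3 : r ^ (∑ i ∈ s, m i) * (B / (3 ^ (∑ i ∈ s, m i) * r ^ (∑ i ∈ s, m i)))
      = B / 3 ^ (∑ i ∈ s, m i) := by field_simp
  rwa [h3, one_le_div (by positivity)] at h1

theorem IsMultiplicitySequence.norm_mono {lam : ℕ → ℂ} {mu : ℕ → ℕ}
    (hΛ : IsMultiplicitySequence lam mu) : Monotone fun n => ‖lam n‖ :=
  monotone_nat_of_le_succ hΛ.norm_le

/-- An interpolating variety for the entire functions of exponential type zero has density zero. -/
theorem IsInterpolatingVariety.sum_mult_le {lam : ℕ → ℂ} {mu : ℕ → ℕ}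
    (hΛ : IsMultiplicitySequence lam mu) (hI : IsInterpolatingVariety lam mu)
    {ε : ℝ} (hε : 0 < ε) :
    ∃ C : ℝ, ∀ n, ((∑ m ∈ Finset.range (n + 1), mu m : ℕ) : ℝ) ≤ ε * ‖lam n‖ + C := by
  obtain ⟨f, ⟨hf, hfb⟩, hfi⟩ := hI (fun n k => if n = 0 ∧ k = 0 then 1 else 0) (by
    intro ε hε
    refine ⟨1, ?_⟩
    rintro _ ⟨n, rfl⟩
    calc _ ≤ ∑ k ∈ Finset.range (mu n), if k = 0 then (1 : ℝ) else 0 := by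
          refine Finset.sum_le_sum fun k _ => ?_
          have : Real.exp (-ε * ‖lam n‖) ≤ 1 :=
            Real.exp_le_one_iff.2 (by nlinarith [norm_nonneg (lam n)])
          by_cases hk : k = 0 <;> by_cases hn : n = 0 <;> simp_all
      _ ≤ 1 := by
          rw [Finset.sum_ite_eq']
          split_ifs <;> norm_num)
  have hf0 : f (lam 0) = 1 := by simpa using hfi 0 0 (hΛ.mult_pos 0)
  have hord : ∀ n, n ≠ 0 → (mu n : ℕ∞) ≤ analyticOrderAt f (lam n) := by
    intro n hn
    rw [natCast_le_analyticOrderAt_iff_iteratedDeriv_eq_zero (hf.analyticAt _)]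
    intro k hk
    have := hfi n k hk
    simpa [hn, Nat.factorial_ne_zero] using this
  -- The zeros lie within `2‖λₙ‖` of `λ₀`, so Jensen's circle has radius `8‖λₙ‖`; hence `ε / 8`.
  obtain ⟨M, hM, hMb⟩ := hfb (ε / 8) (by positivity)
  refine ⟨Real.log M + ε / 8 * ‖lam 0‖ + mu 0, fun n => ?_⟩
  have hpos : 0 < ‖lam n‖ := norm_pos_iff.2 (hΛ.ne_zero n)
  have key := three_pow_sum_le_of_zeros hf hΛ.injective mu ((Finset.range (n + 1)).erase 0)
    (fun i hi => hord i (Finset.ne_of_mem_erase hi)) hf0 (r := 2 * ‖lam n‖)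
    (B := M * Real.exp (ε / 8 * (8 * ‖lam n‖ + ‖lam 0‖))) (by positivity)
    (fun i hi => by
      have hi' : i ≤ n := by
        have := Finset.mem_range.1 (Finset.mem_of_mem_erase hi); omega
      have h1 := hΛ.norm_mono hi'
      have h2 := hΛ.norm_mono (Nat.zero_le n)
      simp only at h1 h2
      linarith [norm_sub_le (lam i) (lam 0)])
    (fun z hz => by
      refine (hMb z).trans ?_
      gcongr
      have h1 : z = (z - lam 0) + lam 0 := by ring
      calc ‖z‖ = ‖(z - lam 0) + lam 0‖ := by rw [← h1]
        _ ≤ ‖z - lam 0‖ + ‖lam 0‖ := norm_add_le _ _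
        _ = _ := by rw [hz]; ring)
  set N := ∑ i ∈ (Finset.range (n + 1)).erase 0, mu i with hNdef
  have hsum : ∑ m ∈ Finset.range (n + 1), mu m = N + mu 0 :=
    (Finset.sum_erase_add _ _ (by simp)).symm
  have h1 := Real.log_le_log (by positivity) key
  rw [Real.log_pow, Real.log_mul hM.ne' (Real.exp_ne_zero _), Real.log_exp] at h1
  have h3 : (1 : ℝ) ≤ Real.log 3 := by
    rw [Real.le_log_iff_exp_le (by norm_num)]
    linarith [Real.exp_one_lt_d9]
  have h4 : (N : ℝ) ≤ N * Real.log 3 := le_mul_of_one_le_right (by positivity) h3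
  rw [hsum]; push_cast
  linarith

theorem IsInterpolatingVariety.mult_le {lam : ℕ → ℂ} {mu : ℕ → ℕ}
    (hΛ : IsMultiplicitySequence lam mu) (hI : IsInterpolatingVariety lam mu)
    {ε : ℝ} (hε : 0 < ε) : ∃ C : ℝ, ∀ n, (mu n : ℝ) ≤ ε * ‖lam n‖ + C := by
  obtain ⟨C, hC⟩ := hI.sum_mult_le hΛ hε
  refine ⟨C, fun n => le_trans ?_ (hC n)⟩
  exact_mod_cast Finset.single_le_sum (f := mu) (fun _ _ => Nat.zero_le _)
    (Finset.self_mem_range_succ n)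

/-- Multiplicities are at least `1`, so density zero gives `n ≤ ε‖λₙ‖ + C`, and `∑ e^(-n)`
dominates. -/
theorem IsInterpolatingVariety.summable_exp {lam : ℕ → ℂ} {mu : ℕ → ℕ}
    (hΛ : IsMultiplicitySequence lam mu) (hI : IsInterpolatingVariety lam mu)
    {ε : ℝ} (hε : 0 < ε) : Summable fun n => Real.exp (-ε * ‖lam n‖) := by
  obtain ⟨C, hC⟩ := hI.sum_mult_le hΛ hε
  refine Summable.of_nonneg_of_le (fun _ => (Real.exp_pos _).le) (fun n => ?_)
    (Real.summable_exp_neg_nat.mul_left (Real.exp C))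
  rw [← Real.exp_add, Real.exp_le_exp]
  have h1 : (n : ℝ) ≤ ((∑ m ∈ Finset.range (n + 1), mu m : ℕ) : ℝ) := by
    have : ∑ m ∈ Finset.range (n + 1), 1 ≤ ∑ m ∈ Finset.range (n + 1), mu m :=
      Finset.sum_le_sum fun i _ => hΛ.mult_pos i
    simp only [Finset.sum_const, Finset.card_range, smul_eq_mul, mul_one] at this
    exact_mod_cast (Nat.le_succ n).trans this
  linarith [hC n]

/-- The multiplicities contribute only subexponential factors. -/
theorem IsInterpolatingVariety.mult_mul_pow_le {lam : ℕ → ℂ} {mu : ℕ → ℕ}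
    (hΛ : IsMultiplicitySequence lam mu) (hI : IsInterpolatingVariety lam mu)
    {ε A : ℝ} (hε : 0 < ε) (hA : 1 ≤ A) :
    ∃ C : ℝ, 0 < C ∧ ∀ n, mu n * A ^ mu n ≤ C * Real.exp (ε * ‖lam n‖) := by
  have hL : 0 ≤ Real.log A := Real.log_nonneg hA
  obtain ⟨C, hC⟩ := hI.mult_le hΛ (ε := ε / (1 + Real.log A)) (by positivity)
  refine ⟨Real.exp ((1 + Real.log A) * C), Real.exp_pos _, fun n => ?_⟩
  have h1 : (mu n : ℝ) ≤ Real.exp (mu n) := by linarith [Real.add_one_le_exp (mu n : ℝ)]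
  have h2 : A ^ mu n = Real.exp (mu n * Real.log A) := by
    rw [← Real.log_pow, Real.exp_log (by positivity)]
  calc (mu n : ℝ) * A ^ mu n ≤ Real.exp (mu n) * A ^ mu n := by gcongr
    _ = Real.exp ((1 + Real.log A) * mu n) := by rw [h2, ← Real.exp_add]; ring_nf
    _ ≤ Real.exp ((1 + Real.log A) * (ε / (1 + Real.log A) * ‖lam n‖ + C)) := by
        gcongr; exact hC n
    _ = _ := by
        rw [← Real.exp_add]; congr 1; field_simp; ring

/-! ### Differential operators of infinite order -/

theorem IsEntireOfTypeZero.norm_iteratedDeriv_zero_le {F : ℂ → ℂ} (hF : IsEntireOfTypeZero F)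
    {ρ : ℝ} (hρ : 0 < ρ) :
    ∃ C : ℝ, 0 < C ∧ ∀ j, ‖iteratedDeriv j F 0‖ ≤ C * ρ ^ j := by
  have he := Real.exp_pos 1
  obtain ⟨M, hM, hMb⟩ := hF.2 (ρ / Real.exp 1) (by positivity)
  set ε := ρ / Real.exp 1 with hεdef
  have hε : 0 < ε := by positivity
  refine ⟨M * Real.exp 1, by positivity, fun j => ?_⟩
  -- This radius balances `e^(εR)` against `R^(-j)`; `j + 1` instead of `j` keeps it positive at `j
  -- = 0`.
  have hR : 0 < (j + 1) / ε := by positivity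
  have h1 := Complex.norm_iteratedDeriv_le_of_forall_mem_sphere_norm_le (c := 0) (f := F)
    (C := M * Real.exp (j + 1)) j hR hF.1.diffContOnCl (fun z hz => by
      refine (hMb z).trans (le_of_eq ?_)
      rw [mem_sphere_zero_iff_norm.1 hz]; field_simp)
  refine h1.trans ?_
  have h2 : (j.factorial : ℝ) ≤ (j + 1) ^ j := by
    calc (j.factorial : ℝ) ≤ (j : ℝ) ^ j := by exact_mod_cast Nat.factorial_le_pow j
      _ ≤ _ := by gcongr; linarith
  have h3 : ρ = ε * Real.exp 1 := by rw [hεdef]; field_simp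
  rw [div_pow, h3, mul_pow, div_div_eq_mul_div, div_le_iff₀ (by positivity), ← Real.exp_nat_mul,
    Real.exp_add, mul_one]
  calc (j.factorial : ℝ) * (M * (Real.exp j * Real.exp 1)) * ε ^ j
      ≤ (j + 1) ^ j * (M * (Real.exp j * Real.exp 1)) * ε ^ j := by gcongr
    _ = _ := by ring

/-- The differential operator of infinite order `F(d/dz)`. -/
noncomputable def infOrderDiff (F φ : ℂ → ℂ) (z : ℂ) : ℂ :=
  ∑' j : ℕ, iteratedDeriv j F 0 / (j.factorial : ℂ) * iteratedDeriv j φ z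

theorem infOrderDiff_congr {F φ ψ : ℂ → ℂ} {z : ℂ} (h : φ =ᶠ[𝓝 z] ψ) :
    infOrderDiff F φ z = infOrderDiff F ψ z := by
  unfold infOrderDiff
  congr 1; ext j
  rw [h.iteratedDeriv_eq j]

/-- Cauchy's estimate `j! B / ρ^j` meets Taylor data of size `C (ρ/2)^j`. Type zero supplies such
data for every `ρ`, which makes the operator local. -/
theorem norm_infOrderDiff_term_le {F φ : ℂ → ℂ} {C ρ B : ℝ} (hC : 0 < C) (hρ : 0 < ρ)
    (hF : ∀ j, ‖iteratedDeriv j F 0‖ ≤ C * (ρ / 2) ^ j) {z : ℂ}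
    (hφ : DifferentiableOn ℂ φ (Metric.closedBall z ρ))
    (hB : ∀ w ∈ Metric.closedBall z ρ, ‖φ w‖ ≤ B) (j : ℕ) :
    ‖iteratedDeriv j F 0 / (j.factorial : ℂ) * iteratedDeriv j φ z‖ ≤ C * B * (1 / 2) ^ j := by
  have h1 := Complex.norm_iteratedDeriv_le_of_forall_mem_sphere_norm_le (c := z) (f := φ)
    (C := B) j hρ (hφ.diffContOnCl_ball subset_rfl)
    (fun w hw => hB w (Metric.sphere_subset_closedBall hw))
  have hf : (0 : ℝ) < j.factorial := by positivity
  rw [norm_mul, norm_div, Complex.norm_natCast]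
  calc _ ≤ C * (ρ / 2) ^ j / j.factorial * (j.factorial * B / ρ ^ j) := by
        gcongr; exact hF j
    _ = _ := by rw [div_pow, one_div, inv_pow]; field_simp

theorem summable_infOrderDiff {F φ : ℂ → ℂ} (hF : IsEntireOfTypeZero F) {ρ : ℝ} (hρ : 0 < ρ)
    {z : ℂ} (hφ : DifferentiableOn ℂ φ (Metric.closedBall z ρ)) :
    Summable fun j : ℕ => iteratedDeriv j F 0 / (j.factorial : ℂ) * iteratedDeriv j φ z := by
  obtain ⟨C, hC, hCb⟩ := hF.norm_iteratedDeriv_zero_le (ρ := ρ / 2) (by positivity)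
  obtain ⟨B, hB⟩ := (isCompact_closedBall z ρ).exists_bound_of_continuousOn hφ.continuousOn
  exact Summable.of_norm_bounded (summable_geometric_two.mul_left (C * B))
    (norm_infOrderDiff_term_le hC hρ hCb hφ hB)

theorem norm_infOrderDiff_le {F : ℂ → ℂ} (hF : IsEntireOfTypeZero F) {ρ : ℝ} (hρ : 0 < ρ) :
    ∃ C : ℝ, 0 < C ∧ ∀ (φ : ℂ → ℂ) (z : ℂ) (B : ℝ),
      DifferentiableOn ℂ φ (Metric.closedBall z ρ) →
      (∀ w ∈ Metric.closedBall z ρ, ‖φ w‖ ≤ B) → ‖infOrderDiff F φ z‖ ≤ C * B := by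
  obtain ⟨C, hC, hCb⟩ := hF.norm_iteratedDeriv_zero_le (ρ := ρ / 2) (by positivity)
  refine ⟨C * 2, by positivity, fun φ z B hφ hB => ?_⟩
  have := tsum_of_norm_bounded (hasSum_geometric_two.mul_left (C * B))
    (norm_infOrderDiff_term_le hC hρ hCb hφ hB)
  calc _ ≤ C * B * 2 := this
    _ = _ := by ring

theorem infOrderDiff_sub {F φ ψ : ℂ → ℂ} (hF : IsEntireOfTypeZero F) {z : ℂ}
    (hφ : AnalyticAt ℂ φ z) (hψ : AnalyticAt ℂ ψ z) :
    infOrderDiff F (fun x => φ x - ψ x) z = infOrderDiff F φ z - infOrderDiff F ψ z := by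
  have hs : ∀ χ : ℂ → ℂ, AnalyticAt ℂ χ z → Summable fun j : ℕ =>
      iteratedDeriv j F 0 / (j.factorial : ℂ) * iteratedDeriv j χ z := by
    intro χ hχ
    obtain ⟨ρ, hρ, h⟩ := Metric.nhds_basis_closedBall.eventually_iff.1 hχ.eventually_analyticAt
    exact summable_infOrderDiff hF hρ fun w hw => (h hw).differentiableAt.differentiableWithinAt
  unfold infOrderDiff
  rw [← (hs φ hφ).tsum_sub (hs ψ hψ)]
  congr 1; ext j
  have := iteratedDeriv_fun_sub (n := j) hφ.contDiffAt hψ.contDiffAt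
  rw [this, mul_sub]

theorem infOrderDiff_sum {F : ℂ → ℂ} (hF : IsEntireOfTypeZero F) {z : ℂ} {ι : Type*}
    (s : Finset ι) (φ : ι → ℂ → ℂ) (hφ : ∀ i ∈ s, Differentiable ℂ (φ i)) :
    infOrderDiff F (fun x => ∑ i ∈ s, φ i x) z = ∑ i ∈ s, infOrderDiff F (φ i) z := by
  unfold infOrderDiff
  rw [← Summable.tsum_finsetSum fun i hi =>
    summable_infOrderDiff hF one_pos (hφ i hi).differentiableOn]
  congr 1; ext j
  rw [iteratedDeriv_fun_sum fun i hi => (hφ i hi).contDiff.contDiffAt, Finset.mul_sum]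

theorem infOrderDiff_const_mul {F φ : ℂ → ℂ} {z : ℂ} (a : ℂ) :
    infOrderDiff F (fun x => a * φ x) z = a * infOrderDiff F φ z := by
  unfold infOrderDiff
  rw [← tsum_mul_left]
  congr 1; ext j
  rw [iteratedDeriv_const_mul_field]; ring

theorem tendsto_infOrderDiff {F g : ℂ → ℂ} (hF : IsEntireOfTypeZero F) {S : ℕ → ℂ → ℂ} {z : ℂ}
    {ρ : ℝ} (hρ : 0 < ρ) (hS : ∀ N, Differentiable ℂ (S N))
    (hg : AnalyticOnNhd ℂ g (Metric.closedBall z ρ))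
    (h : TendstoUniformlyOn S g atTop (Metric.closedBall z ρ)) :
    Tendsto (fun N => infOrderDiff F (S N) z) atTop (𝓝 (infOrderDiff F g z)) := by
  obtain ⟨C, hC, hCb⟩ := norm_infOrderDiff_le hF hρ
  have hz : z ∈ Metric.closedBall z ρ := Metric.mem_closedBall_self hρ.le
  rw [Metric.tendsto_atTop]
  intro ε hε
  obtain ⟨N₀, hN₀⟩ := eventually_atTop.1
    (Metric.tendstoUniformlyOn_iff.1 h (ε / (2 * C)) (by positivity))
  refine ⟨N₀, fun N hN => ?_⟩
  rw [dist_eq_norm, ← infOrderDiff_sub hF ((hS N).analyticAt z) (hg z hz)]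
  refine lt_of_le_of_lt (hCb _ z (ε / (2 * C)) ?_ fun w hw => ?_) ?_
  · exact (hS N).differentiableOn.sub hg.differentiableOn
  · rw [← dist_eq_norm, dist_comm]; exact (hN₀ N hN w hw).le
  · have : C * (ε / (2 * C)) = ε / 2 := by field_simp
    linarith

theorem iteratedDeriv_sub_pow_mul_exp (k j : ℕ) (l z : ℂ) :
    iteratedDeriv j (fun x => (x - z) ^ k * Complex.exp (l * x)) z
      = (j.descFactorial k : ℂ) * l ^ (j - k) * Complex.exp (l * z) := by
  rw [iteratedDeriv_fun_mul (by fun_prop) (by fun_prop)]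
  have h : ∀ i, iteratedDeriv i (fun x : ℂ => (x - z) ^ k) z = if i = k then (k.factorial : ℂ) else 0 := by
    intro i
    rw [iteratedDeriv_comp_sub_const (f := fun x : ℂ => x ^ k)]
    simp only [sub_self, iteratedDeriv_fun_pow_zero]
    simp [eq_comm]
  simp only [iteratedDeriv_cexp_const_mul, h]
  simp only [mul_ite, mul_zero, ite_mul, zero_mul, Finset.sum_ite_eq', Finset.mem_range]
  rw [Nat.descFactorial_eq_factorial_mul_choose]
  split_ifs with hk
  · push_cast; ring
  · rw [Nat.choose_eq_zero_of_lt (by omega)]; simp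

/-- Only the orders `j ≥ k` contribute; shifted by `k`, they form the Taylor series of the `k`-th
derivative of `F` about `0`. -/
theorem infOrderDiff_sub_pow_mul_exp {F : ℂ → ℂ} (hF : IsEntireOfTypeZero F) (k : ℕ) (l z : ℂ) :
    infOrderDiff F (fun x => (x - z) ^ k * Complex.exp (l * x)) z
      = iteratedDeriv k F l * Complex.exp (l * z) := by
  have hd : Differentiable ℂ (iteratedDeriv k F) :=
    (hF.1.contDiff (n := ⊤)).differentiable_iteratedDeriv k (by exact_mod_cast WithTop.coe_lt_top _)
  have h1 := Complex.hasSum_taylorSeries_of_entire hd 0 l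
  have h2 := h1.mul_right (Complex.exp (l * z))
  rw [← h2.tsum_eq]
  unfold infOrderDiff
  rw [← (add_left_injective k).tsum_eq]
  · refine tsum_congr fun m => ?_
    rw [iteratedDeriv_sub_pow_mul_exp]
    have h3 : iteratedDeriv m (iteratedDeriv k F) 0 = iteratedDeriv (m + k) F 0 := by
      simp only [iteratedDeriv_eq_iterate, Function.iterate_add_apply]
    have h4 : ((m + k).factorial : ℂ) = m.factorial * (m + k).descFactorial k := by
      have := Nat.factorial_mul_descFactorial (Nat.le_add_left k m)
      rw [Nat.add_sub_cancel] at this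
      exact_mod_cast this.symm
    have h5 : ((m + k).factorial : ℂ) ≠ 0 := by exact_mod_cast (m + k).factorial_ne_zero
    rw [h4] at h5
    have h6 := left_ne_zero_of_mul h5
    have h7 := right_ne_zero_of_mul h5
    rw [h3, h4, Nat.add_sub_cancel, smul_eq_mul, smul_eq_mul, sub_zero]
    field_simp
  · intro j hj
    rw [Function.mem_support, iteratedDeriv_sub_pow_mul_exp] at hj
    have : k ≤ j := by
      by_contra hlt
      exact hj (by rw [Nat.descFactorial_eq_zero_iff_lt.2 (by omega)]; simp)
    exact ⟨j - k, Nat.sub_add_cancel this⟩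

theorem Polynomial.eval_add_eq_sum_derivative (P : ℂ[X]) {d : ℕ} (hd : P.natDegree < d)
    (z w : ℂ) :
    P.eval (z + w) = ∑ k ∈ Finset.range d,
      (derivative^[k] P).eval z / (k.factorial : ℂ) * w ^ k := by
  rw [add_comm, ← taylor_eval, eval_eq_sum_range' (by rwa [natDegree_taylor])]
  refine Finset.sum_congr rfl fun k _ => ?_
  have hk : (k.factorial : ℂ) ≠ 0 := by exact_mod_cast k.factorial_ne_zero
  have h : (derivative^[k] P).eval z = k.factorial * (hasseDeriv k P).eval z := by
    rw [← factorial_smul_hasseDeriv]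
    simp
  rw [taylor_coeff, h, mul_div_cancel_left₀ _ hk]

/-- The interpolation data of `F` at `l` appear as weights on the derivatives of `P`, so prescribing
them can select a single derivative. -/
theorem infOrderDiff_polynomial_mul_exp {F : ℂ → ℂ} (hF : IsEntireOfTypeZero F) (P : ℂ[X]) {d : ℕ}
    (hd : P.natDegree < d) (l z : ℂ) :
    infOrderDiff F (fun x => P.eval x * Complex.exp (l * x)) z
      = Complex.exp (l * z) * ∑ k ∈ Finset.range d,
        iteratedDeriv k F l / (k.factorial : ℂ) * (derivative^[k] P).eval z := by
  have h1 : (fun x => P.eval x * Complex.exp (l * x)) = fun x => ∑ k ∈ Finset.range d,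
      (derivative^[k] P).eval z / (k.factorial : ℂ) * ((x - z) ^ k * Complex.exp (l * x)) := by
    ext x
    have h2 := P.eval_add_eq_sum_derivative hd z (x - z)
    rw [add_sub_cancel] at h2
    rw [h2, Finset.sum_mul]
    exact Finset.sum_congr rfl fun k _ => by ring
  rw [h1, infOrderDiff_sum hF _ _ fun k _ => by fun_prop, Finset.mul_sum]
  refine Finset.sum_congr rfl fun k _ => ?_
  rw [infOrderDiff_const_mul, infOrderDiff_sub_pow_mul_exp hF]
  ring

/-! ### Sector geometry and the region of exponential decay -/

theorem re_bounds_of_abs_arg_le {η : ℝ} (hη0 : 0 ≤ η) (hη : η < Real.pi / 2) {w : ℂ}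
    (hw : |w.arg| ≤ η) : ‖w‖ * Real.cos η ≤ w.re ∧ |w.im| ≤ w.re * Real.tan η := by
  have hcos : 0 < Real.cos η := Real.cos_pos_of_mem_Ioo ⟨by linarith, hη⟩
  have h1 : w.re = ‖w‖ * Real.cos |w.arg| := by rw [Real.cos_abs, Complex.norm_mul_cos_arg]
  have h2 : |w.im| = ‖w‖ * Real.sin |w.arg| := by
    rw [← Complex.norm_mul_sin_arg w, abs_mul, abs_norm, Real.abs_sin_eq_sin_abs_of_abs_le_pi]
    linarith [Real.pi_pos]
  refine ⟨?_, ?_⟩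
  · rw [h1]
    exact mul_le_mul_of_nonneg_left (Real.cos_le_cos_of_nonneg_of_le_pi (abs_nonneg _)
      (by linarith [Real.pi_pos]) hw) (norm_nonneg _)
  · rw [h1, h2, mul_assoc]
    refine mul_le_mul_of_nonneg_left ?_ (norm_nonneg _)
    rw [Real.tan_eq_sin_div_cos, ← mul_div_assoc, le_div_iff₀ hcos]
    have h3 : 0 ≤ Real.sin (η - |w.arg|) :=
      Real.sin_nonneg_of_nonneg_of_le_pi (by linarith) (by linarith [abs_nonneg w.arg, Real.pi_pos])
    rw [Real.sin_sub] at h3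
    linarith

theorem Complex.re_mul_le_norm_mul_norm (a b : ℂ) : (a * b).re ≤ ‖a‖ * ‖b‖ := by
  rw [← norm_mul]; exact Complex.re_le_norm _

/-- The points at which the terms of the series decay exponentially. -/
def decayRegion (lam : ℕ → ℂ) (mu : ℕ → ℕ) (c : ℕ → ℕ → ℂ) : Set ℂ :=
  {z | ∃ δ : ℝ, 0 < δ ∧ ∃ M : ℝ, ∀ n, ∀ k < mu n,
    ‖c n k‖ * Real.exp (lam n * z).re ≤ M * Real.exp (-δ * ‖lam n‖)}

/-- A displacement of size `δ / 2` costs at most `e^(δ‖λₙ‖/2)`, half of the available decay. -/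
theorem decay_of_near {lam : ℕ → ℂ} {mu : ℕ → ℕ} {c : ℕ → ℕ → ℂ} {z w : ℂ} {δ M : ℝ}
    (h : ∀ n, ∀ k < mu n, ‖c n k‖ * Real.exp (lam n * z).re ≤ M * Real.exp (-δ * ‖lam n‖))
    (hw : ‖w - z‖ ≤ δ / 2) (n k : ℕ) (hk : k < mu n) :
    ‖c n k‖ * Real.exp (lam n * w).re ≤ M * Real.exp (-(δ / 2) * ‖lam n‖) := by
  have h1 : (lam n * w).re = (lam n * z).re + (lam n * (w - z)).re := by
    rw [← Complex.add_re]; congr 1; ring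
  have h2 : (lam n * (w - z)).re ≤ δ / 2 * ‖lam n‖ := by
    refine (Complex.re_mul_le_norm_mul_norm _ _).trans ?_
    rw [mul_comm]; gcongr
  rw [h1, Real.exp_add, ← mul_assoc]
  calc _ ≤ M * Real.exp (-δ * ‖lam n‖) * Real.exp (δ / 2 * ‖lam n‖) :=
        mul_le_mul (h n k hk) (Real.exp_le_exp.2 h2) (Real.exp_pos _).le
          ((by positivity : (0 : ℝ) ≤ _).trans (h n k hk))
    _ = _ := by rw [mul_assoc, ← Real.exp_add]; ring_nf

theorem isOpen_decayRegion (lam : ℕ → ℂ) (mu : ℕ → ℕ) (c : ℕ → ℕ → ℂ) :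
    IsOpen (decayRegion lam mu c) := by
  rw [Metric.isOpen_iff]
  rintro z ⟨δ, hδ, M, hM⟩
  refine ⟨δ / 2, by positivity, fun w hw => ⟨δ / 2, by positivity, M, fun n k hk => ?_⟩⟩
  exact decay_of_near hM (by rw [← dist_eq_norm]; exact (Metric.mem_ball.1 hw).le) n k hk

theorem convex_decayRegion (lam : ℕ → ℂ) (mu : ℕ → ℕ) (c : ℕ → ℕ → ℂ) :
    Convex ℝ (decayRegion lam mu c) := by
  rintro x ⟨δ, hδ, M, hM⟩ y ⟨δ', hδ', M', hM'⟩ a b ha hb hab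
  refine ⟨min δ δ', lt_min hδ hδ', max (max M M') 0, fun n k hk => ?_⟩
  have h1 : (lam n * (a • x + b • y)).re = a * (lam n * x).re + b * (lam n * y).re := by
    simp only [Complex.real_smul, Complex.mul_re, Complex.add_re, Complex.add_im,
      Complex.ofReal_re, Complex.ofReal_im, Complex.mul_im]
    ring
  have h2 : a * (lam n * x).re + b * (lam n * y).re ≤ max (lam n * x).re (lam n * y).re := by
    have e1 := mul_le_mul_of_nonneg_left (le_max_left (lam n * x).re (lam n * y).re) ha
    have e2 := mul_le_mul_of_nonneg_left (le_max_right (lam n * x).re (lam n * y).re) hb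
    calc _ ≤ _ := add_le_add e1 e2
      _ = _ := by rw [← add_mul, hab, one_mul]
  have h3 : ∀ r : ℝ, (r = δ ∨ r = δ') → ∀ m : ℝ, (m = M ∨ m = M') →
      m * Real.exp (-r * ‖lam n‖) ≤ max (max M M') 0 * Real.exp (-min δ δ' * ‖lam n‖) := by
    intro r hr m hm
    have : m ≤ max (max M M') 0 := by rcases hm with rfl | rfl <;> simp
    have : min δ δ' ≤ r := by rcases hr with rfl | rfl <;> simp
    gcongr
  rw [h1]
  calc _ ≤ ‖c n k‖ * Real.exp (max (lam n * x).re (lam n * y).re) := by gcongr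
    _ ≤ _ := by
      rcases max_choice (lam n * x).re (lam n * y).re with h | h <;> rw [h]
      · exact (hM n k hk).trans (h3 _ (.inl rfl) _ (.inl rfl))
      · exact (hM' n k hk).trans (h3 _ (.inr rfl) _ (.inr rfl))

theorem openSector_subset_decayRegion {lam : ℕ → ℂ} {mu : ℕ → ℕ} {η : ℝ} (hη0 : 0 ≤ η)
    (hη : η < Real.pi / 2) (harg : ∀ n, |(lam n).arg| ≤ η) {β : ℝ} {c : ℕ → ℕ → ℂ}
    (hc : ∀ ε : ℝ, 0 < ε → ∃ m : ℝ, 0 < m ∧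
      ∀ n : ℕ, ∀ k < mu n, ‖c n k‖ ≤ m * Real.exp ((-β + ε) * (lam n).re)) :
    openSector η β ⊆ decayRegion lam mu c := by
  rintro z ⟨hz1, hz2⟩
  have hcos : 0 < Real.cos η := Real.cos_pos_of_mem_Ioo ⟨by linarith, hη⟩
  -- `d` is the slack in the sector condition: half pays for the `ε` in the coefficient bound, and
  -- the other half remains as decay in `Re λₙ ≥ ‖λₙ‖ cos η`.
  set d := β - z.re - |z.im| * Real.tan η with hd
  have hdpos : 0 < d := by linarith
  obtain ⟨m, hm, hmb⟩ := hc (d / 2) (by positivity)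
  refine ⟨d / 2 * Real.cos η, by positivity, m, fun n k hk => ?_⟩
  obtain ⟨h1, h2⟩ := re_bounds_of_abs_arg_le hη0 hη (harg n)
  have h3 : (lam n * z).re ≤ (lam n).re * (β - d) := by
    have e1 : -((lam n).im * z.im) ≤ |(lam n).im| * |z.im| := by
      rw [← abs_mul]; exact neg_le_abs _
    have e2 := mul_le_mul_of_nonneg_right h2 (abs_nonneg z.im)
    rw [Complex.mul_re]
    have : (lam n).re * (β - d) = (lam n).re * z.re + (lam n).re * Real.tan η * |z.im| := by
      rw [hd]; ring
    linarith
  calc _ ≤ m * Real.exp ((-β + d / 2) * (lam n).re) * Real.exp ((lam n).re * (β - d)) := by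
        gcongr; exact hmb n k hk
    _ = m * Real.exp (-(d / 2) * (lam n).re) := by rw [mul_assoc, ← Real.exp_add]; ring_nf
    _ ≤ _ := by
      refine mul_le_mul_of_nonneg_left (Real.exp_le_exp.2 ?_) hm.le
      have := mul_le_mul_of_nonneg_left h1 (by positivity : 0 ≤ d / 2)
      linarith

/-! ### Convergence on the region of decay -/

/-- The polynomial coefficient of `exp (lam n * z)`. -/
noncomputable def coeffPoly (mu : ℕ → ℕ) (c : ℕ → ℕ → ℂ) (n : ℕ) : ℂ[X] :=
  ∑ k ∈ Finset.range (mu n), C (c n k) * X ^ k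

theorem coeffPoly_eval (mu : ℕ → ℕ) (c : ℕ → ℕ → ℂ) (n : ℕ) (z : ℂ) :
    (coeffPoly mu c n).eval z = ∑ k ∈ Finset.range (mu n), c n k * z ^ k := by
  simp [coeffPoly, eval_finsetSum]

theorem natDegree_coeffPoly_lt {mu : ℕ → ℕ} (c : ℕ → ℕ → ℂ) {n : ℕ} (hn : 0 < mu n) :
    (coeffPoly mu c n).natDegree < mu n := by
  have : (coeffPoly mu c n).natDegree ≤ mu n - 1 := by
    refine natDegree_sum_le_of_forall_le _ _ fun k hk => ?_
    have := Finset.mem_range.1 hk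
    exact (natDegree_C_mul_X_pow_le _ _).trans (by omega)
  omega

theorem coeff_coeffPoly {mu : ℕ → ℕ} (c : ℕ → ℕ → ℂ) {n k : ℕ} (hk : k < mu n) :
    (coeffPoly mu c n).coeff k = c n k := by
  simp [coeffPoly, hk]

theorem taylorDirichletPartialSum_eq (lam : ℕ → ℂ) (mu : ℕ → ℕ) (c : ℕ → ℕ → ℂ) (N : ℕ) :
    taylorDirichletPartialSum lam mu c N =
      fun z => ∑ n ∈ Finset.range N, (coeffPoly mu c n).eval z * Complex.exp (lam n * z) := by
  ext z
  simp only [taylorDirichletPartialSum, coeffPoly_eval]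

theorem differentiable_taylorDirichletPartialSum (lam : ℕ → ℂ) (mu : ℕ → ℕ) (c : ℕ → ℕ → ℂ)
    (N : ℕ) : Differentiable ℂ (taylorDirichletPartialSum lam mu c N) := by
  rw [taylorDirichletPartialSum_eq]
  fun_prop

theorem taylorDirichletDefines_decayRegion {lam : ℕ → ℂ} {mu : ℕ → ℕ}
    (hΛ : IsMultiplicitySequence lam mu) (hI : IsInterpolatingVariety lam mu) (c : ℕ → ℕ → ℂ) :
    ∃ g, TaylorDirichletDefines lam mu c g (decayRegion lam mu c) := by
  set g : ℂ → ℂ := fun z => ∑' n, (coeffPoly mu c n).eval z * Complex.exp (lam n * z)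
  have hopen := isOpen_decayRegion lam mu c
  have hloc : TendstoLocallyUniformlyOn (taylorDirichletPartialSum lam mu c) g atTop
      (decayRegion lam mu c) := by
    intro U hU z hz
    obtain ⟨δ, hδ, M, hM⟩ := hz
    -- On the disc of radius `δ / 2` the decay rate is `δ / 2`; the polynomial factors use `δ / 4`
    -- of it, leaving a summable majorant for the M-test.
    obtain ⟨C, hC, hCb⟩ := hI.mult_mul_pow_le hΛ (ε := δ / 4) (A := 1 + ‖z‖ + δ / 2)
      (by positivity) (by linarith [norm_nonneg z])
    have hM0 : 0 ≤ M := by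
      have := (by positivity : (0 : ℝ) ≤ _).trans (hM 0 0 (hΛ.mult_pos 0))
      exact nonneg_of_mul_nonneg_left this (Real.exp_pos _)
    have hsum := (hI.summable_exp hΛ (ε := δ / 4) (by positivity)).mul_left (M * C)
    refine ⟨Metric.closedBall z (δ / 2),
      mem_nhdsWithin_of_mem_nhds (Metric.closedBall_mem_nhds _ (by positivity)), ?_⟩
    have := tendstoUniformlyOn_tsum_nat hsum (s := Metric.closedBall z (δ / 2))
      (f := fun n w => (coeffPoly mu c n).eval w * Complex.exp (lam n * w)) (fun n w hw => by
        have hwz : ‖w - z‖ ≤ δ / 2 := by rw [← dist_eq_norm]; exact hw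
        have hwn : ‖w‖ ≤ 1 + ‖z‖ + δ / 2 := by
          have := norm_le_norm_add_norm_sub' w z
          linarith
        set A := 1 + ‖z‖ + δ / 2
        have hA : 1 ≤ A := by simp only [A]; linarith [norm_nonneg z]
        rw [coeffPoly_eval, Finset.sum_mul]
        calc _ ≤ ∑ k ∈ Finset.range (mu n), M * Real.exp (-(δ / 2) * ‖lam n‖) * A ^ mu n := by
              refine norm_sum_le_of_le _ fun k hk => ?_
              have hk' := Finset.mem_range.1 hk
              rw [norm_mul, norm_mul, norm_pow, Complex.norm_exp, mul_right_comm]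
              have e2 : ‖w‖ ^ k ≤ A ^ mu n :=
                (pow_le_pow_left₀ (norm_nonneg _) hwn k).trans (pow_le_pow_right₀ hA hk'.le)
              exact mul_le_mul (decay_of_near hM hwz n k hk') e2 (by positivity) (by positivity)
          _ = M * Real.exp (-(δ / 2) * ‖lam n‖) * (mu n * A ^ mu n) := by
              rw [Finset.sum_const, Finset.card_range, nsmul_eq_mul]; ring
          _ ≤ M * Real.exp (-(δ / 2) * ‖lam n‖) * (C * Real.exp (δ / 4 * ‖lam n‖)) := by
              exact mul_le_mul_of_nonneg_left (hCb n) (by positivity)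
          _ = M * C * (Real.exp (-(δ / 2) * ‖lam n‖) * Real.exp (δ / 4 * ‖lam n‖)) := by ring
          _ = _ := by rw [← Real.exp_add]; ring_nf)
    filter_upwards [this U hU] with N hN w hw
    rw [taylorDirichletPartialSum_eq]
    exact hN w hw
  refine ⟨g, ?_, ?_⟩
  · refine DifferentiableOn.analyticOnNhd ?_ hopen
    exact hloc.differentiableOn (Eventually.of_forall fun N =>
      (differentiable_taylorDirichletPartialSum lam mu c N).differentiableOn) hopen
  · exact (tendstoLocallyUniformlyOn_iff_forall_isCompact hopen).1 hloc

theorem TaylorDirichletDefines.mono {lam : ℕ → ℂ} {mu : ℕ → ℕ} {c : ℕ → ℕ → ℂ} {g : ℂ → ℂ}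
    {U V : Set ℂ} (h : TaylorDirichletDefines lam mu c g V) (hUV : U ⊆ V) :
    TaylorDirichletDefines lam mu c g U :=
  ⟨h.1.mono hUV, fun K hK => h.2 K (hK.trans hUV)⟩

/-! ### Coefficient bounds from convergence -/

/-- A late term is a difference of two partial sums, each within `1` of `g`; the finitely many early
ones are bounded by compactness. -/
theorem TaylorDirichletDefines.exists_term_bound {lam : ℕ → ℂ} {mu : ℕ → ℕ} {c : ℕ → ℕ → ℂ}
    {g : ℂ → ℂ} {U K : Set ℂ} (h : TaylorDirichletDefines lam mu c g U) (hKU : K ⊆ U)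
    (hK : IsCompact K) :
    ∃ B : ℝ, 0 < B ∧ ∀ n, ∀ z ∈ K, ‖(coeffPoly mu c n).eval z * Complex.exp (lam n * z)‖ ≤ B := by
  obtain ⟨N, hN⟩ := eventually_atTop.1 (Metric.tendstoUniformlyOn_iff.1 (h.2 K hKU hK) 1 one_pos)
  have hb : ∀ n, ∃ b : ℝ, ∀ z ∈ K, ‖(coeffPoly mu c n).eval z * Complex.exp (lam n * z)‖ ≤ b :=
    fun n => hK.exists_bound_of_continuousOn (by fun_prop)
  choose b hb using hb
  refine ⟨2 + ∑ n ∈ Finset.range N, |b n|, by positivity, fun n z hz => ?_⟩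
  rcases lt_or_ge n N with hn | hn
  · have h1 := Finset.single_le_sum (f := fun n => |b n|) (fun _ _ => abs_nonneg _)
      (Finset.mem_range.2 hn)
    linarith [hb n z hz, le_abs_self (b n)]
  · have h1 := hN n hn z hz
    have h2 := hN (n + 1) (by omega) z hz
    have h3 : (coeffPoly mu c n).eval z * Complex.exp (lam n * z)
        = taylorDirichletPartialSum lam mu c (n + 1) z - taylorDirichletPartialSum lam mu c n z := by
      simp only [taylorDirichletPartialSum_eq, Finset.sum_range_succ, add_sub_cancel_left]
    rw [h3, ← dist_eq_norm]
    have h4 := dist_triangle_left (taylorDirichletPartialSum lam mu c (n + 1) z)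
      (taylorDirichletPartialSum lam mu c n z) (g z)
    have h5 : 0 ≤ ∑ n ∈ Finset.range N, |b n| := by positivity
    linarith

theorem Polynomial.iteratedDeriv_eval (P : ℂ[X]) (k : ℕ) :
    iteratedDeriv k (fun z => P.eval z) = fun z => (derivative^[k] P).eval z := by
  induction k with
  | zero => simp
  | succ k ih =>
    rw [iteratedDeriv_succ, ih, Function.iterate_succ_apply']
    ext z
    exact Polynomial.deriv _

/-- Cauchy's estimate for the Taylor coefficients of a polynomial. -/
theorem Polynomial.norm_derivative_eval_le {P : ℂ[X]} {a : ℂ} {ρ B : ℝ} (hρ : 0 < ρ)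
    (hB : ∀ z ∈ Metric.closedBall a ρ, ‖P.eval z‖ ≤ B) (k : ℕ) :
    ‖(derivative^[k] P).eval a / (k.factorial : ℂ)‖ ≤ B / ρ ^ k := by
  have h1 := Complex.norm_iteratedDeriv_le_of_forall_mem_sphere_norm_le (c := a)
    (f := fun z => P.eval z) (C := B) k hρ (P.differentiable.diffContOnCl)
    (fun z hz => hB z (Metric.sphere_subset_closedBall hz))
  rw [P.iteratedDeriv_eval] at h1
  rw [norm_div, Complex.norm_natCast, div_le_iff₀ (by positivity)]
  refine h1.trans (le_of_eq (by ring))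

theorem Polynomial.derivative_eval_zero (P : ℂ[X]) (k : ℕ) :
    (derivative^[k] P).eval 0 = k.factorial * P.coeff k := by
  rw [← coeff_zero_eq_eval_zero, coeff_iterate_derivative]
  simp [Nat.descFactorial_self]

/-- Taylor expansion at `a` carries the bound to the unit disc about `0`, where Cauchy's estimate
reads off coefficients. With `d = mu n` the loss is subexponential. -/
theorem Polynomial.norm_coeff_le_of_bound_on_closedBall {P : ℂ[X]} {d : ℕ} (hd : P.natDegree < d)
    {a : ℂ} {ρ B : ℝ} (hρ : 0 < ρ) (hB : ∀ z ∈ Metric.closedBall a ρ, ‖P.eval z‖ ≤ B) (k : ℕ) :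
    ‖P.coeff k‖ ≤ B * (d * (1 + (1 + ‖a‖) / ρ) ^ d) := by
  set A := 1 + (1 + ‖a‖) / ρ
  have hA1 : 1 ≤ A := by simp only [A, le_add_iff_nonneg_right]; positivity
  have hB0 : 0 ≤ B := (norm_nonneg _).trans (hB a (Metric.mem_closedBall_self hρ.le))
  have h1 : ∀ z ∈ Metric.closedBall (0 : ℂ) 1, ‖P.eval z‖ ≤ B * (d * A ^ d) := by
    intro z hz
    have hz' : ‖z - a‖ ≤ 1 + ‖a‖ :=
      (norm_sub_le _ _).trans (by linarith [mem_closedBall_zero_iff.1 hz])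
    have h2 := P.eval_add_eq_sum_derivative hd a (z - a)
    rw [add_sub_cancel] at h2
    rw [h2]
    calc _ ≤ ∑ k ∈ Finset.range d, B * A ^ d := by
          refine norm_sum_le_of_le _ fun j hj => ?_
          rw [norm_mul, norm_pow]
          calc _ ≤ B / ρ ^ j * (1 + ‖a‖) ^ j := by
                gcongr; exact norm_derivative_eval_le hρ hB j
            _ = B * ((1 + ‖a‖) / ρ) ^ j := by rw [div_pow]; ring
            _ ≤ B * A ^ j := by
                gcongr; simp only [A]; linarith
            _ ≤ _ := by
                gcongr; exact (Finset.mem_range.1 hj).le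
      _ = _ := by rw [Finset.sum_const, Finset.card_range, nsmul_eq_mul]; ring
  have h3 := norm_derivative_eval_le one_pos h1 k
  rwa [P.derivative_eval_zero, mul_div_cancel_left₀ _ (by exact_mod_cast k.factorial_ne_zero),
    one_pow, div_one] at h3

theorem TaylorDirichletDefines.coeff_bound {lam : ℕ → ℂ} {mu : ℕ → ℕ}
    (hΛ : IsMultiplicitySequence lam mu) (hI : IsInterpolatingVariety lam mu)
    {η : ℝ} (hη0 : 0 ≤ η) (hη : η < Real.pi / 2) (harg : ∀ n, |(lam n).arg| ≤ η)
    {β : ℝ} {c : ℕ → ℕ → ℂ} {g : ℂ → ℂ}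
    (hg : TaylorDirichletDefines lam mu c g (openSector η β)) {ε : ℝ} (hε : 0 < ε) :
    ∃ m : ℝ, 0 < m ∧ ∀ n : ℕ, ∀ k < mu n, ‖c n k‖ ≤ m * Real.exp ((-β + ε) * (lam n).re) := by
  have hcos : 0 < Real.cos η := Real.cos_pos_of_mem_Ioo ⟨by linarith, hη⟩
  have htan : 0 ≤ Real.tan η := Real.tan_nonneg_of_nonneg_of_le_pi_div_two hη0 hη.le
  -- The disc about `β - ε/4` must fit in the sector, and `ρ‖λₙ‖` must be at most `(ε/8) Re λₙ`.
  -- Centre, radius and multiplicities then cost `ε/4 + ε/8 + ε/8 ≤ ε`.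
  set ρ := ε / 8 * Real.cos η / (1 + Real.tan η) with hρdef
  have hρ : 0 < ρ := by positivity
  have hρ1 : ρ * (1 + Real.tan η) = ε / 8 * Real.cos η := by rw [hρdef]; field_simp
  have hρ2 : ε / 8 * Real.cos η ≤ ε / 8 := mul_le_of_le_one_right (by positivity) (Real.cos_le_one η)
  have hρ3 : ρ ≤ ε / 8 * Real.cos η := by
    rw [← hρ1]; exact le_mul_of_one_le_right hρ.le (by linarith)
  have hK : Metric.closedBall ((β - ε / 4 : ℝ) : ℂ) ρ ⊆ openSector η β := by
    intro z hz
    rw [mem_closedBall_iff_norm] at hz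
    have h1 := (Complex.re_le_norm _).trans hz
    have h2 := (Complex.abs_im_le_norm _).trans hz
    rw [Complex.sub_re, Complex.ofReal_re] at h1
    rw [Complex.sub_im, Complex.ofReal_im, sub_zero] at h2
    have h3 := mul_le_mul_of_nonneg_right h2 htan
    exact ⟨by linarith, by linarith⟩
  obtain ⟨B, hB, hBb⟩ := hg.exists_term_bound hK (isCompact_closedBall _ _)
  obtain ⟨C, hC, hCb⟩ := hI.mult_mul_pow_le hΛ (ε := ε / 8 * Real.cos η)
    (A := 1 + (1 + ‖((β - ε / 4 : ℝ) : ℂ)‖) / ρ) (by positivity)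
    (by rw [le_add_iff_nonneg_right]; positivity)
  refine ⟨B * C, by positivity, fun n k hk => ?_⟩
  have hre := (re_bounds_of_abs_arg_le hη0 hη (harg n)).1
  have hre0 : 0 ≤ (lam n).re := le_trans (by positivity) hre
  have h1 : ∀ z ∈ Metric.closedBall ((β - ε / 4 : ℝ) : ℂ) ρ, ‖(coeffPoly mu c n).eval z‖ ≤
      B * Real.exp ((-β + ε / 4) * (lam n).re + ρ * ‖lam n‖) := by
    intro z hz
    have h2 := hBb n z hz
    rw [norm_mul, Complex.norm_exp, ← le_div_iff₀ (Real.exp_pos _), div_eq_mul_inv,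
      ← Real.exp_neg] at h2
    refine h2.trans ?_
    gcongr
    rw [mem_closedBall_iff_norm, norm_sub_rev] at hz
    have h3 := Complex.re_mul_le_norm_mul_norm (lam n) (((β - ε / 4 : ℝ) : ℂ) - z)
    have h4 := mul_le_mul_of_nonneg_left hz (norm_nonneg (lam n))
    rw [mul_sub, Complex.sub_re, Complex.re_mul_ofReal] at h3
    linarith
  have h2 := Polynomial.norm_coeff_le_of_bound_on_closedBall
    (natDegree_coeffPoly_lt c (hΛ.mult_pos n)) hρ h1 k
  rw [coeff_coeffPoly c hk] at h2
  calc _ ≤ _ := h2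
    _ ≤ B * Real.exp ((-β + ε / 4) * (lam n).re + ρ * ‖lam n‖) *
        (C * Real.exp (ε / 8 * Real.cos η * ‖lam n‖)) :=
        mul_le_mul_of_nonneg_left (hCb n) (by positivity)
    _ = B * C * Real.exp ((-β + ε / 4) * (lam n).re + ρ * ‖lam n‖ +
        ε / 8 * Real.cos η * ‖lam n‖) := by rw [Real.exp_add _ (ε / 8 * Real.cos η * ‖lam n‖)]; ring
    _ ≤ _ := by
      gcongr
      have e1 := mul_le_mul_of_nonneg_right hρ3 (norm_nonneg (lam n))
      have e2 := mul_le_mul_of_nonneg_left hre (by positivity : 0 ≤ ε / 8)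
      nlinarith

/-! ### Estimates for polynomials and sparse exponential sums -/

/-- The Taylor sum is dominated by the exponential series. If `P` dominates its own derivatives at
`z`, its relative variation nearby is thus controlled independently of the degree. -/
theorem Polynomial.norm_eval_add_sub_le {P : ℂ[X]} {z : ℂ} {B : ℝ}
    (hB : ∀ k, ‖(derivative^[k] P).eval z‖ ≤ B) (w : ℂ) :
    ‖P.eval (z + w) - P.eval z‖ ≤ B * (Real.exp ‖w‖ - 1) := by
  have hB0 : 0 ≤ B := (norm_nonneg _).trans (hB 0)
  rw [P.eval_add_eq_sum_derivative (Nat.lt_succ_self _), Finset.sum_range_succ']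
  simp only [Function.iterate_zero, id, Nat.factorial_zero, Nat.cast_one, div_one, pow_zero,
    mul_one, add_sub_cancel_right]
  have h1 : ∑ k ∈ Finset.range P.natDegree, ‖w‖ ^ (k + 1) / ((k + 1).factorial : ℝ)
      ≤ Real.exp ‖w‖ - 1 := by
    have := Real.sum_le_exp_of_nonneg (norm_nonneg w) (P.natDegree + 1)
    rw [Finset.sum_range_succ'] at this
    simp only [pow_zero, Nat.factorial_zero, Nat.cast_one, div_one] at this
    linarith
  refine le_trans ?_ (mul_le_mul_of_nonneg_left h1 hB0)
  rw [Finset.mul_sum]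
  refine norm_sum_le_of_le _ fun k _ => ?_
  rw [norm_mul, norm_div, norm_pow, Complex.norm_natCast, div_mul_eq_mul_div, mul_div_assoc]
  exact mul_le_mul_of_nonneg_right (hB _) (by positivity)

/-- The order of a largest derivative of a polynomial at a point. -/
theorem Polynomial.exists_max_derivative (P : ℂ[X]) {d : ℕ} (hd : P.natDegree < d) (z : ℂ) :
    ∃ κ < d, ∀ k, ‖(derivative^[k] P).eval z‖ ≤ ‖(derivative^[κ] P).eval z‖ := by
  obtain ⟨κ, hκ, h⟩ := Finset.exists_max_image (Finset.range d)
    (fun k => ‖(derivative^[k] P).eval z‖) ⟨P.natDegree, Finset.mem_range.2 hd⟩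
  refine ⟨κ, Finset.mem_range.1 hκ, fun k => ?_⟩
  rcases lt_or_ge k d with hk | hk
  · exact h k (Finset.mem_range.2 hk)
  · rw [iterate_derivative_eq_zero (by omega)]
    simp

/-- Moving from `z` to `0` costs only `e^‖z‖`, so a large coefficient forces a large derivative at
`z`. -/
theorem Polynomial.norm_coeff_le_exp_mul {P : ℂ[X]} {z : ℂ} {B : ℝ}
    (hB : ∀ k, ‖(derivative^[k] P).eval z‖ ≤ B) (k : ℕ) :
    ‖P.coeff k‖ ≤ B * Real.exp ‖z‖ := by
  have h1 := norm_eval_add_sub_le (P := derivative^[k] P) (z := z) (B := B)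
    (fun j => by rw [← Function.iterate_add_apply]; exact hB _) (-z)
  rw [add_neg_cancel, derivative_eval_zero, norm_neg] at h1
  have h2 := norm_le_norm_add_norm_sub' ((k.factorial : ℂ) * P.coeff k) ((derivative^[k] P).eval z)
  have h3 : ‖P.coeff k‖ ≤ ‖(k.factorial : ℂ) * P.coeff k‖ := by
    rw [norm_mul, Complex.norm_natCast]
    exact le_mul_of_one_le_left (norm_nonneg _) (by exact_mod_cast k.factorial_pos)
  linarith [hB k]

theorem Complex.norm_exp_sub_one_le_exp_norm_sub_one (w : ℂ) :
    ‖Complex.exp w - 1‖ ≤ Real.exp ‖w‖ - 1 := by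
  simpa using Complex.norm_exp_sub_sum_le_exp_norm_sub_sum w 1

/-- Both factors lie within `e^(1/8) - 1` of `1`, hence their product within `e^(1/4) - 1 ≤ 1/3`. -/
theorem re_exp_mul_ge {u w R : ℂ} (hu : ‖u‖ ≤ 1 / 8) (hw : ‖w‖ ≤ 1 / 8)
    (hR : ‖R - 1‖ ≤ Real.exp ‖w‖ - 1) : 2 / 3 ≤ (Complex.exp u * R).re := by
  have h1 : ‖Complex.exp u * R - 1‖ ≤ Real.exp (1 / 4) - 1 := by
    have e1 : Complex.exp u * R - 1 = Complex.exp u * (R - 1) + (Complex.exp u - 1) := by ring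
    have e2 : Real.exp (1 / 4) = Real.exp (1 / 8) * Real.exp (1 / 8) := by
      rw [← Real.exp_add]; norm_num
    have e3 : ‖Complex.exp u‖ ≤ Real.exp (1 / 8) := by
      rw [Complex.norm_exp]
      exact Real.exp_le_exp.2 ((Complex.re_le_norm u).trans hu)
    have e4 : ‖R - 1‖ ≤ Real.exp (1 / 8) - 1 := hR.trans (by gcongr)
    have e5 := (Complex.norm_exp_sub_one_le_exp_norm_sub_one u).trans
      (sub_le_sub_right (Real.exp_le_exp.2 hu) 1)
    rw [e1]
    refine (norm_add_le _ _).trans ?_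
    rw [norm_mul]
    have e6 := mul_le_mul e3 e4 (norm_nonneg _) (Real.exp_pos _).le
    rw [e2]; linarith
  have h2 : Real.exp (1 / 4) ≤ 4 / 3 := by
    have := Real.add_one_le_exp (-(1 / 4) : ℝ)
    rw [Real.exp_neg] at this
    have h3 := Real.exp_pos (1 / 4)
    have h4 := mul_le_mul_of_nonneg_right this h3.le
    rw [inv_mul_cancel₀ h3.ne'] at h4
    linarith
  have h3 := (Complex.abs_re_le_norm _).trans h1
  rw [Complex.sub_re, Complex.one_re] at h3
  linarith [(abs_le.1 h3).1]

theorem norm_exp_mul_le {u w R : ℂ} {x : ℝ} (hx : 0 < x) (hu : u.re ≤ -x) (hw : ‖w‖ ≤ 1 / 8)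
    (hR : ‖R - 1‖ ≤ Real.exp ‖w‖ - 1) : ‖Complex.exp u * R‖ ≤ 2 / x := by
  have h1 : ‖R‖ ≤ 2 := by
    have e1 : Real.exp ‖w‖ ≤ 2 := by
      rw [← Real.le_log_iff_exp_le (by norm_num)]
      linarith [Real.log_two_gt_d9]
    have e2 := norm_le_norm_add_norm_sub' R 1
    rw [norm_one] at e2
    linarith
  have h2 : Real.exp u.re ≤ 1 / x := by
    refine (Real.exp_le_exp.2 hu).trans ?_
    rw [Real.exp_neg, one_div]
    exact inv_anti₀ hx (by linarith [Real.add_one_le_exp x])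
  rw [norm_mul, Complex.norm_exp]
  calc _ ≤ 1 / x * 2 := mul_le_mul h2 h1 (norm_nonneg _) (by positivity)
    _ = _ := by ring

theorem two_pow_mul_le_of_doubling {l : ℕ → ℝ} (hl : ∀ i, 2 * l i ≤ l (i + 1)) (i m : ℕ) :
    2 ^ m * l i ≤ l (i + m) := by
  induction m with
  | zero => simp
  | succ m ih =>
    have := hl (i + m)
    rw [pow_succ, ← add_assoc]; linarith

/-- Doubling gives `l K / l (K + m) ≤ 2^(-m)`, so the terms past `K` sum to at most `A` in norm,
whatever `J` is. -/
theorem re_sum_ge_of_doubling {T : ℕ → ℂ} {l : ℕ → ℝ} (hl0 : ∀ i, 0 < l i)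
    (hl : ∀ i, 2 * l i ≤ l (i + 1)) {K J : ℕ} (hKJ : K < J) {A : ℝ} (hA : 0 ≤ A)
    (h1 : ∀ i ≤ K, 2 / 3 ≤ (T i).re) (h2 : ∀ i, K < i → ‖T i‖ ≤ A * (l K / l i)) :
    2 / 3 * K - A ≤ (∑ i ∈ Finset.range J, T i).re := by
  obtain ⟨m, rfl⟩ := Nat.exists_eq_add_of_le (Nat.succ_le_of_lt hKJ)
  rw [Finset.sum_range_add, Complex.add_re]
  have e1 : 2 / 3 * (K : ℝ) ≤ (∑ i ∈ Finset.range K.succ, T i).re := by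
    rw [Complex.re_sum]
    have := Finset.card_nsmul_le_sum (Finset.range K.succ) (fun i => (T i).re) (2 / 3)
      fun i hi => h1 i (Nat.lt_succ_iff.1 (Finset.mem_range.1 hi))
    rw [Finset.card_range, nsmul_eq_mul] at this
    push_cast at this
    linarith
  have e2 : ‖∑ i ∈ Finset.range m, T (K.succ + i)‖ ≤ A := by
    calc _ ≤ ∑ i ∈ Finset.range m, A / 2 / 2 ^ i := by
          refine norm_sum_le_of_le _ fun i _ => (h2 _ (by omega)).trans ?_
          have h3 := two_pow_mul_le_of_doubling hl K (i + 1)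
          have h4 : l K / l (K.succ + i) ≤ 1 / 2 ^ (i + 1) := by
            rw [div_le_div_iff₀ (hl0 _) (by positivity)]
            have : K.succ + i = K + (i + 1) := by omega
            rw [this]; linarith
          calc _ ≤ A * (1 / 2 ^ (i + 1)) := mul_le_mul_of_nonneg_left h4 hA
            _ = _ := by rw [pow_succ]; field_simp
      _ ≤ ∑' i : ℕ, A / 2 / 2 ^ i :=
          (summable_geometric_two' A).sum_le_tsum _ fun i _ => by positivity
      _ = A := tsum_geometric_two' A
  have e3 := (Complex.abs_re_le_norm _).trans e2
  linarith [(abs_le.1 e3).1]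

/-- If only finitely many indices satisfied the conditions for some `i`, the terms would decay
exponentially at `z₀`. Comparing decay at `p` with its near absence at `z₀` shows that `λₙ` has a
definite decay direction `p - z₀`. -/
theorem exists_sparse_subsequence {lam : ℕ → ℂ} {mu : ℕ → ℕ}
    (hΛ : IsMultiplicitySequence lam mu) {c : ℕ → ℕ → ℂ} {p z₀ : ℂ}
    (hp : p ∈ decayRegion lam mu c) (hz₀ : z₀ ∉ decayRegion lam mu c) :
    ∃ δ : ℝ, 0 < δ ∧ ∃ σ : ℕ → ℕ, StrictMono σ ∧
      (∀ i, 2 * ‖lam (σ i)‖ ≤ ‖lam (σ (i + 1))‖) ∧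
      ∀ i, 1 ≤ ‖lam (σ i)‖ ∧ (lam (σ i) * (p - z₀)).re ≤ -δ * ‖lam (σ i)‖ ∧
        ∃ k < mu (σ i), Real.exp (-(1 / ((i : ℝ) + 1)) * ‖lam (σ i)‖) ≤
          ‖c (σ i) k‖ * Real.exp (lam (σ i) * z₀).re := by
  obtain ⟨δ, hδ, M, hM⟩ := hp
  set Q : ℕ → ℕ → Prop := fun i n => 1 ≤ ‖lam n‖ ∧ (lam n * (p - z₀)).re ≤ -(δ / 4) * ‖lam n‖ ∧
    ∃ k < mu n, Real.exp (-(1 / ((i : ℝ) + 1)) * ‖lam n‖) ≤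
      ‖c n k‖ * Real.exp (lam n * z₀).re with hQ
  have hfreq : ∀ i, ∃ᶠ n in atTop, Q i n := by
    intro i hnot
    apply hz₀
    set ε := min (1 / ((i : ℝ) + 1)) (δ / 2)
    have hε : 0 < ε := lt_min (by positivity) (by positivity)
    have hev : ∀ᶠ n in atTop, ¬ Q i n ∧ 1 ≤ ‖lam n‖ ∧ 4 / δ * Real.log (max M 1) ≤ ‖lam n‖ :=
      (show ∀ᶠ n in atTop, ¬ Q i n from hnot).and
        ((hΛ.tendsto_norm.eventually_ge_atTop 1).and (hΛ.tendsto_norm.eventually_ge_atTop _))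
    obtain ⟨N, hN⟩ := eventually_atTop.1 hev
    set b : ℕ → ℕ → ℝ := fun n k =>
      ‖c n k‖ * Real.exp (lam n * z₀).re * Real.exp (ε * ‖lam n‖)
    have hb0 : ∀ n k, 0 ≤ b n k := fun n k => by positivity
    refine ⟨ε, hε, 1 + ∑ n ∈ Finset.range N, ∑ k ∈ Finset.range (mu n), b n k,
      fun n k hk => ?_⟩
    have hS : 0 ≤ ∑ n ∈ Finset.range N, ∑ k ∈ Finset.range (mu n), b n k :=
      Finset.sum_nonneg fun n _ => Finset.sum_nonneg fun k _ => hb0 n k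
    rcases lt_or_ge n N with hn | hn
    · have h1 : b n k ≤ ∑ n ∈ Finset.range N, ∑ k ∈ Finset.range (mu n), b n k :=
        (Finset.single_le_sum (f := b n) (fun k _ => hb0 n k) (Finset.mem_range.2 hk)).trans
          (Finset.single_le_sum (f := fun n => ∑ k ∈ Finset.range (mu n), b n k)
            (fun n _ => Finset.sum_nonneg fun k _ => hb0 n k) (Finset.mem_range.2 hn))
      have h2 : ‖c n k‖ * Real.exp (lam n * z₀).re = b n k * Real.exp (-ε * ‖lam n‖) := by
        simp only [b]
        rw [mul_assoc, ← Real.exp_add]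
        ring_nf
        simp
      rw [h2]
      refine mul_le_mul_of_nonneg_right ?_ (Real.exp_pos _).le
      linarith
    · obtain ⟨hq, hn1, hn2⟩ := hN n hn
      have h1 : ‖c n k‖ * Real.exp (lam n * z₀).re ≤ Real.exp (-ε * ‖lam n‖) := by
        by_contra! hlt
        refine hq ⟨hn1, ?_, k, hk, le_trans ?_ hlt.le⟩
        · have e1 : (lam n * p).re = (lam n * z₀).re + (lam n * (p - z₀)).re := by
            rw [← Complex.add_re]; congr 1; ring
          have e2 := hM n k hk
          rw [e1, Real.exp_add, ← mul_assoc] at e2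
          have e3 : Real.exp (-ε * ‖lam n‖) * Real.exp (lam n * (p - z₀)).re ≤
              Real.exp (Real.log (max M 1)) * Real.exp (-δ * ‖lam n‖) := by
            rw [Real.exp_log (by positivity)]
            calc _ ≤ ‖c n k‖ * Real.exp (lam n * z₀).re * Real.exp (lam n * (p - z₀)).re := by
                  gcongr
              _ ≤ _ := e2
              _ ≤ _ := by gcongr; exact le_max_left _ _
          rw [← Real.exp_add, ← Real.exp_add, Real.exp_le_exp] at e3
          have e4 : ε * ‖lam n‖ ≤ δ / 2 * ‖lam n‖ := by gcongr; exact min_le_right _ _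
          have e5 : Real.log (max M 1) ≤ δ / 4 * ‖lam n‖ := by
            calc _ = δ / 4 * (4 / δ * Real.log (max M 1)) := by field_simp
              _ ≤ _ := by gcongr
          linarith
        · have : ε ≤ 1 / ((i : ℝ) + 1) := min_le_left _ _
          gcongr
      calc _ ≤ _ := h1
        _ ≤ _ := le_mul_of_one_le_left (Real.exp_pos _).le (by linarith)
  obtain ⟨φ, hφ, hφQ⟩ := extraction_forall_of_frequently hfreq
  -- A second extraction secures doubling; passing to later indices only strengthens the rate `1 /
  -- (i + 1)`.
  have hnext : ∀ i, ∃ j, i < j ∧ 2 * ‖lam (φ i)‖ ≤ ‖lam (φ j)‖ := fun i =>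
    ((eventually_gt_atTop i).and
      ((hΛ.tendsto_norm.comp hφ.tendsto_atTop).eventually_ge_atTop _)).exists
  choose s hs using hnext
  set ψ : ℕ → ℕ := fun i => s^[i] 0
  have hψs : ∀ i, ψ (i + 1) = s (ψ i) := fun i => Function.iterate_succ_apply' _ _ _
  have hψ : StrictMono ψ := strictMono_nat_of_lt_succ fun i => by rw [hψs]; exact (hs _).1
  refine ⟨δ / 4, by positivity, φ ∘ ψ, hφ.comp hψ, fun i => ?_, fun i => ?_⟩
  · simp only [Function.comp, hψs]
    exact (hs _).2
  · obtain ⟨h1, h2, k, hk, h3⟩ := hφQ (ψ i)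
    refine ⟨h1, h2, k, hk, le_trans ?_ h3⟩
    have : (i : ℝ) ≤ ψ i := by exact_mod_cast hψ.le_apply
    simp only [Function.comp]
    gcongr

open Classical in
/-- Interpolation of data carried by a subsequence, in a single order at each node. -/
theorem IsInterpolatingVariety.exists_sparse {lam : ℕ → ℂ} {mu : ℕ → ℕ}
    (hI : IsInterpolatingVariety lam mu) {σ : ℕ → ℕ} (hσ : StrictMono σ) (κ : ℕ → ℕ) (b : ℕ → ℂ)
    {B : ℝ} (hb : ∀ i, ‖b (σ i)‖ ≤ B * Real.exp (1 / ((i : ℝ) + 1) * ‖lam (σ i)‖)) :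
    ∃ f, IsEntireOfTypeZero f ∧ ∀ n, ∀ k < mu n, iteratedDeriv k f (lam n) / (k.factorial : ℂ)
      = if n ∈ Set.range σ ∧ k = κ n then b n else 0 := by
  refine hI (fun n k => if n ∈ Set.range σ ∧ k = κ n then b n else 0) fun ε hε => ?_
  refine IsBoundedUnder.bddAbove_range ⟨max B 0, ?_⟩
  obtain ⟨I, hII⟩ := exists_nat_one_div_lt hε
  rw [eventually_map]
  filter_upwards [eventually_ge_atTop (σ I)] with n hn
  by_cases hnσ : n ∈ Set.range σ
  · obtain ⟨i, rfl⟩ := hnσ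
    have hIi : I ≤ i := hσ.le_iff_le.1 hn
    have h1 : 1 / ((i : ℝ) + 1) ≤ ε := by
      refine le_trans ?_ hII.le
      have : (I : ℝ) ≤ i := by exact_mod_cast hIi
      gcongr
    have h2 : ‖b (σ i)‖ * Real.exp (-ε * ‖lam (σ i)‖) ≤ max B 0 := by
      calc _ ≤ max B 0 * Real.exp (ε * ‖lam (σ i)‖) * Real.exp (-ε * ‖lam (σ i)‖) := by
            gcongr
            refine (hb i).trans ?_
            gcongr
            exact le_max_left _ _
        _ = _ := by rw [mul_assoc, ← Real.exp_add]; simp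
    calc _ ≤ ∑ k ∈ Finset.range (mu (σ i)), if k = κ (σ i) then max B 0 else 0 := by
          refine Finset.sum_le_sum fun k _ => ?_
          by_cases hk : k = κ (σ i)
          · simpa [hk] using h2
          · simp [hk]
      _ ≤ _ := by
          rw [Finset.sum_ite_eq']
          split_ifs
          · exact le_rfl
          · exact le_max_right _ _
  · simp [hnσ]

/-! ### The natural boundary and the main theorem -/

theorem isNaturalBoundary_decayRegion {lam : ℕ → ℂ} {mu : ℕ → ℕ}
    (hΛ : IsMultiplicitySequence lam mu) (hI : IsInterpolatingVariety lam mu) {c : ℕ → ℕ → ℂ}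
    {g : ℂ → ℂ} (hg : TaylorDirichletDefines lam mu c g (decayRegion lam mu c)) :
    IsNaturalBoundary g (decayRegion lam mu c) := by
  classical
  rintro z₀ hz₀ ⟨G, hG, hGg⟩
  set D := decayRegion lam mu c with hD
  have hopen : IsOpen D := isOpen_decayRegion lam mu c
  have hcl : z₀ ∈ closure D := hz₀.1
  have hnot : z₀ ∉ D := by
    rw [frontier, hopen.interior_eq] at hz₀; exact hz₀.2
  obtain ⟨p, hp⟩ := closure_nonempty_iff.1 ⟨z₀, hcl⟩
  obtain ⟨δ, hδ, σ, hσ, hdouble, hσQ⟩ := exists_sparse_subsequence hΛ hp hnot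
  set v := p - z₀ with hv
  set P := coeffPoly mu c with hP
  have hPdeg : ∀ n, (P n).natDegree < mu n := fun n => natDegree_coeffPoly_lt c (hΛ.mult_pos n)
  -- Selecting the largest derivative at `z₀` makes `q n` dominate its own derivatives there, so `q
  -- n (z₀ + w) / q n z₀` is near `1` uniformly in `n` on the subsequence.
  choose κ hκ hκmax using fun n => (P n).exists_max_derivative (hPdeg n) z₀
  set q : ℕ → ℂ[X] := fun n => derivative^[κ n] (P n) with hq
  have hqmax : ∀ n k, ‖(derivative^[k] (q n)).eval z₀‖ ≤ ‖(q n).eval z₀‖ := fun n k => by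
    simp only [hq, ← Function.iterate_add_apply]; exact hκmax n _
  have hqlow : ∀ i : ℕ, Real.exp (-(1 / ((i : ℝ) + 1)) * ‖lam (σ i)‖) ≤
      ‖(q (σ i)).eval z₀‖ * Real.exp ‖z₀‖ * Real.exp (lam (σ i) * z₀).re := by
    intro i
    obtain ⟨-, -, k, hk, h⟩ := hσQ i
    refine h.trans ?_
    rw [← coeff_coeffPoly c hk]
    gcongr
    exact Polynomial.norm_coeff_le_exp_mul (hκmax (σ i)) k
  have hq0 : ∀ i, (q (σ i)).eval z₀ ≠ 0 := by
    intro i h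
    have := hqlow i
    rw [h, norm_zero, zero_mul, zero_mul] at this
    exact absurd this (not_le.2 (Real.exp_pos _))
  obtain ⟨F, hF, hFI⟩ := hI.exists_sparse hσ κ
    (fun n => ((q n).eval z₀ * Complex.exp (lam n * z₀))⁻¹) (B := Real.exp ‖z₀‖) (fun i => by
      have h1 := hqlow i
      rw [norm_inv, norm_mul, Complex.norm_exp, inv_le_iff_one_le_mul₀
        (mul_pos (norm_pos_iff.2 (hq0 i)) (Real.exp_pos _))]
      have h2 := mul_le_mul_of_nonneg_left h1
        (Real.exp_pos (1 / ((i : ℝ) + 1) * ‖lam (σ i)‖)).le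
      rw [← Real.exp_add, neg_mul, add_neg_cancel, Real.exp_zero] at h2
      linarith)
  have hterm : ∀ n w, infOrderDiff F (fun x => (P n).eval x * Complex.exp (lam n * x)) (z₀ + w)
      = if n ∈ Set.range σ then
        Complex.exp (lam n * w) * ((q n).eval (z₀ + w) / (q n).eval z₀) else 0 := by
    intro n w
    rw [infOrderDiff_polynomial_mul_exp hF (P n) (hPdeg n)]
    have : ∀ k ∈ Finset.range (mu n), iteratedDeriv k F (lam n) / (k.factorial : ℂ) *
        (derivative^[k] (P n)).eval (z₀ + w) = if k = κ n then (if n ∈ Set.range σ then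
          ((q n).eval z₀ * Complex.exp (lam n * z₀))⁻¹ * (q n).eval (z₀ + w) else 0) else 0 := by
      intro k hk
      rw [hFI n k (Finset.mem_range.1 hk)]
      by_cases h1 : k = κ n
      · subst h1
        by_cases h2 : n ∈ Set.range σ <;> simp [h2, hq]
      · simp [h1]
    rw [Finset.sum_congr rfl this, Finset.sum_ite_eq', if_pos (Finset.mem_range.2 (hκ n))]
    split_ifs with h2
    · obtain ⟨i, rfl⟩ := h2
      have e1 := hq0 i
      rw [mul_add, Complex.exp_add]
      field_simp
    · simp
  set l : ℕ → ℝ := fun i => ‖lam (σ i)‖ with hl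
  have hl1 : ∀ i, 1 ≤ l i := fun i => (hσQ i).1
  have hl0 : ∀ i, 0 < l i := fun i => one_pos.trans_le (hl1 i)
  have hltop : Tendsto l atTop atTop := hΛ.tendsto_norm.comp hσ.tendsto_atTop
  set V := ‖v‖ + 1 with hVdef
  have hV : 0 < V := by positivity
  -- This is `2 / x` from `norm_exp_mul_le` at `x = tδ l i`, with the factor `l K / l i` removed. It
  -- does not depend on `K`.
  set A := 16 * V / δ with hAdef
  have hA : 0 ≤ A := by positivity
  obtain ⟨ρ, hρ, hGρ⟩ := Metric.nhds_basis_closedBall.eventually_iff.1 hG.eventually_analyticAt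
  obtain ⟨B, hB⟩ := (isCompact_closedBall z₀ ρ).exists_bound_of_continuousOn
    (fun w hw => (hGρ hw).continuousAt.continuousWithinAt)
  obtain ⟨C, hC, hCb⟩ := norm_infOrderDiff_le hF (ρ := ρ / 2) (by positivity)
  obtain ⟨r, hr, hGr⟩ := Metric.nhdsWithin_basis_ball.eventually_iff.1 hGg
  -- `K` makes `2K/3 - A` exceed the bound `C * B` on `F(d/dz) G`, and puts `z` close enough to `z₀`
  -- for that bound and for `G = g`.
  obtain ⟨K, hK1, hK2⟩ := ((hltop.eventually_gt_atTop (max (1 / r) (2 / ρ))).and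
    (tendsto_natCast_atTop_atTop.eventually_gt_atTop (3 / 2 * (C * B + A)))).exists
  -- At this scale the exponents `λ t v` have norm at most `1/8` up to index `K`; later ones have
  -- real part at most `-tδ l i`.
  set t : ℝ := 1 / (8 * V * l K) with ht
  have hlK := hl0 K
  have ht0 : 0 < t := by positivity
  have htV : t * V = 1 / 8 / l K := by rw [ht]; field_simp
  have hwV : ‖(t : ℂ) * v‖ ≤ t * V := by
    rw [norm_mul, Complex.norm_real, Real.norm_of_nonneg ht0.le]
    gcongr; rw [hVdef]; linarith
  have hw8 : ‖(t : ℂ) * v‖ ≤ 1 / 8 := by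
    refine hwV.trans ?_
    rw [htV]
    exact div_le_self (by norm_num) (hl1 K)
  have hwlt : ∀ s : ℝ, 0 < s → 1 / s < l K → ‖(t : ℂ) * v‖ < s := by
    intro s hs h
    refine hwV.trans_lt ?_
    rw [htV, div_lt_iff₀ hlK]
    rw [div_lt_iff₀ hs] at h
    linarith
  have hwr := hwlt r hr ((le_max_left _ _).trans_lt hK1)
  have hwρ := hwlt (ρ / 2) (by positivity)
    (by rw [one_div_div]; exact (le_max_right _ _).trans_lt hK1)
  have htle : t ≤ 1 := by
    have h1 : t * V ≤ 1 / 8 := by rw [htV]; exact div_le_self (by norm_num) (hl1 K)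
    have h2 : t * 1 ≤ t * V := by gcongr; rw [hVdef]; linarith [norm_nonneg v]
    linarith
  set z := z₀ + (t : ℂ) * v with hz
  have hzz : ‖z - z₀‖ = ‖(t : ℂ) * v‖ := by rw [hz, add_sub_cancel_left]
  have hzD : z ∈ D := by
    have := (convex_decayRegion lam mu c).add_smul_sub_mem_interior' hcl
      (hopen.interior_eq.symm ▸ hp) ⟨ht0, htle⟩
    rw [hopen.interior_eq] at this
    simpa [hz, hv, Complex.real_smul] using this
  have hGz : ‖infOrderDiff F G z‖ ≤ C * B := by
    have hsub : Metric.closedBall z (ρ / 2) ⊆ Metric.closedBall z₀ ρ := by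
      refine Metric.closedBall_subset_closedBall' ?_
      rw [dist_eq_norm, hzz]; linarith
    exact hCb G z B (fun w hw => (hGρ (hsub hw)).differentiableAt.differentiableWithinAt)
      fun w hw => hB w (hsub hw)
  have hGeq : infOrderDiff F G z = infOrderDiff F g z := by
    refine infOrderDiff_congr ?_
    have hzr : z ∈ Metric.ball z₀ r := by rw [Metric.mem_ball, dist_eq_norm, hzz]; exact hwr
    filter_upwards [(Metric.isOpen_ball.inter hopen).mem_nhds ⟨hzr, hzD⟩] with w hw
    exact hGr hw
  obtain ⟨ρ', hρ', hρD⟩ := Metric.nhds_basis_closedBall.mem_iff.1 (hopen.mem_nhds hzD)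
  have hlim := tendsto_infOrderDiff hF hρ' (differentiable_taylorDirichletPartialSum lam mu c)
    (hg.1.mono hρD) (hg.2 _ hρD (isCompact_closedBall _ _))
  -- The partial sum of length `σ J` contains exactly the chosen nodes `σ 0, …, σ (J - 1)`.
  have hlim2 := (Complex.continuous_re.tendsto _).comp (hlim.comp hσ.tendsto_atTop)
  have hsumT : ∀ J, infOrderDiff F (taylorDirichletPartialSum lam mu c (σ J)) z =
      ∑ i ∈ Finset.range J, Complex.exp (lam (σ i) * ((t : ℂ) * v)) *
        ((q (σ i)).eval z / (q (σ i)).eval z₀) := by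
    intro J
    rw [taylorDirichletPartialSum_eq, infOrderDiff_sum hF _ _ fun n _ => by fun_prop]
    rw [← Finset.sum_subset (s₁ := (Finset.range J).image σ)]
    · rw [Finset.sum_image fun a _ b _ h => hσ.injective h]
      exact Finset.sum_congr rfl fun i _ => by rw [hz, hterm, if_pos ⟨i, rfl⟩]
    · intro n hn
      obtain ⟨i, hi, rfl⟩ := Finset.mem_image.1 hn
      exact Finset.mem_range.2 (hσ (Finset.mem_range.1 hi))
    · intro n hn hn'
      rw [hz, hterm, if_neg]
      rintro ⟨i, rfl⟩
      exact hn' (Finset.mem_image_of_mem _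
        (Finset.mem_range.2 (hσ.lt_iff_lt.1 (Finset.mem_range.1 hn))))
  have hR : ∀ i, ‖(q (σ i)).eval z / (q (σ i)).eval z₀ - 1‖ ≤ Real.exp ‖(t : ℂ) * v‖ - 1 := by
    intro i
    have h1 := Polynomial.norm_eval_add_sub_le (hqmax (σ i)) ((t : ℂ) * v)
    have h2 := norm_pos_iff.2 (hq0 i)
    rw [div_sub_one (hq0 i), norm_div, div_le_iff₀ h2, mul_comm]
    exact h1
  have hlow : ∀ J, K < J →
      2 / 3 * K - A ≤ (infOrderDiff F (taylorDirichletPartialSum lam mu c (σ J)) z).re := by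
    intro J hJ
    rw [hsumT]
    refine re_sum_ge_of_doubling hl0 hdouble hJ hA (fun i hi => ?_) fun i _ => ?_
    · refine re_exp_mul_ge ?_ hw8 (hR i)
      have h1 : l i ≤ l K := hΛ.norm_mono (hσ.monotone hi)
      rw [norm_mul]
      calc _ ≤ l K * (t * V) := mul_le_mul h1 hwV (norm_nonneg _) hlK.le
        _ = 1 / 8 := by rw [htV]; field_simp
    · have hli := hl0 i
      have h1 : (lam (σ i) * ((t : ℂ) * v)).re ≤ -(t * (δ * l i)) := by
        have e1 := mul_le_mul_of_nonneg_left (hσQ i).2.1 ht0.le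
        have e2 : lam (σ i) * ((t : ℂ) * v) = (t : ℂ) * (lam (σ i) * v) := by ring
        rw [e2, Complex.re_ofReal_mul]
        linarith
      refine (norm_exp_mul_le (by positivity) h1 hw8 (hR i)).trans (le_of_eq ?_)
      rw [ht, hAdef]; field_simp; norm_num
  have hge : 2 / 3 * K - A ≤ (infOrderDiff F g z).re :=
    ge_of_tendsto hlim2 ((eventually_gt_atTop K).mono hlow)
  rw [← hGeq] at hge
  linarith [(Complex.re_le_norm (infOrderDiff F G z)).trans hGz]

theorem lemma5p1 (lam : ℕ → ℂ) (mu : ℕ → ℕ) (hΛ : IsMultiplicitySequence lam mu)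
    (hI : IsInterpolatingVariety lam mu)
    (η : ℝ) (hη0 : 0 ≤ η) (hη : η < Real.pi / 2) (harg : ∀ n, |(lam n).arg| ≤ η)
    (β : ℝ) (c : ℕ → ℕ → ℂ) :
    ((∃ g : ℂ → ℂ, TaylorDirichletDefines lam mu c g (openSector η β)) ↔
      ∀ ε : ℝ, 0 < ε → ∃ m : ℝ, 0 < m ∧
        ∀ n : ℕ, ∀ k < mu n, ‖c n k‖ ≤ m * Real.exp ((-β + ε) * (lam n).re)) ∧
    ((∃ g : ℂ → ℂ, TaylorDirichletDefines lam mu c g (openSector η β)) →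
      ∃ (g : ℂ → ℂ) (D : Set ℂ), IsOpen D ∧ Convex ℝ D ∧ openSector η β ⊆ D ∧
        TaylorDirichletDefines lam mu c g D ∧
        (D = Set.univ ∨ (D ≠ Set.univ ∧ IsNaturalBoundary g D))) := by
  -- This holds for arbitrary coefficients; their bounds serve only to place the sector inside
  -- `decayRegion`.
  obtain ⟨g, hg⟩ := taylorDirichletDefines_decayRegion hΛ hI c
  have hcoeff : (∃ g : ℂ → ℂ, TaylorDirichletDefines lam mu c g (openSector η β)) →
      ∀ ε : ℝ, 0 < ε → ∃ m : ℝ, 0 < m ∧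
        ∀ n : ℕ, ∀ k < mu n, ‖c n k‖ ≤ m * Real.exp ((-β + ε) * (lam n).re) :=
    fun ⟨_, h⟩ _ hε => h.coeff_bound hΛ hI hη0 hη harg hε
  refine ⟨⟨hcoeff, fun hc => ⟨g, hg.mono (openSector_subset_decayRegion hη0 hη harg hc)⟩⟩,
    fun h => ⟨g, decayRegion lam mu c, isOpen_decayRegion lam mu c, convex_decayRegion lam mu c,
      openSector_subset_decayRegion hη0 hη harg (hcoeff h), hg, ?_⟩⟩
  exact (em _).imp_right fun hne => ⟨hne, isNaturalBoundary_decayRegion hΛ hI hg⟩
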